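/- **Transformers.** Fix a number of heads $h$, a head dimension $d$ (model dimension $m=hd$), and a feedforward width $w$. A causally masked transformer over a finite vocabulary $V$ has rational parameters: an embedding $E:V\to\mathbb Q^m$, a list of layers, and an unembedding $U\in\mathbb Q^{V\times m}$. There are no positional encodings; instead the input is preceded by a beginning-of-sequence token. The residual stream starts as $\mathbf h_i=E(\text{token}_i)$. Each layer is a self-attention sublayer followed by a feedforward sublayer. A sublayer with mask $\mathbf m\in\mathbb Q^m$ reads $\mathbf z_i=\mathsf{layer\_norm}(\mathbf m\odot\mathbf h_i)$ and replaces $\mathbf h_i$ by $\mathbf h_i+\delta_i$. Here layer-norm is either RMS norm $x\mapsto x/\|x\|_2$ or standard layer-norm $x\mapsto (x-\bar x)/\|x-\bar x\|_2$ (with $0\mapsto 0$). - Feedforward: $\delta_i=\mathbf U'\,\mathrm{ReLU}(\mathbf W\mathbf z_i)$ with $\mathbf W\in\mathbb Q^{w\times m}$, $\mathbf U'\in\mathbb Q^{m\times w}$. - Attention: $\delta_i=\mathbf W\cdot\mathrm{concat}(\mathbf a_{i,1},\dots,\mathbf a_{i,h})$, where $\mathbf a_{i,k}$ is the average of the values $\mathbf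 V^k\mathbf z_j$ over those $j\le i$ that maximize $\langle \mathbf Q^k\mathbf z_i,\mathbf K^k\mathbf z_j\rangle$ among all $j\le i$ (averaging-hard attention; $\mathbf Q^k,\mathbf K^k,\mathbf V^k\in\mathbb Q^{d\times m}$). The output is the token whose logit, computed from the residual stream at the last position, is the unique maximum. **Arithmetic.** All computations are carried out in a datatype $\mathbb D\subseteq\mathbb R$: parameters, and the result of every operation (addition, multiplication, ReLU, attention weight, the sum over positions in an attention head, layer-norm), are rounded to the nearest element of $\mathbb D$, ties going to the higher value. Say that $\mathbb D$ has precision $q$ if $k/2^q\in\mathbb D$ for all integers $|k|\le 4^q$. **Corollary (Regular Language Recognition, Non-Uniform).** Let $L$ be a regular language over a finite alphabet $\Sigma$, let $\$\notin\Sigma$, and let layer-norm be either RMS norm or standard layer-norm. There exist $h,d,w,c\in\mathbb N$ and a family $\{T_n\}_{n\ge1}$ of causally masked transformers, all with $h$ heads, model dimension $hd$ and feedforward width $w$, over the vocabulary $\Sigma$ together with $\$$, a beginning-of-sequence token and a token "accept", such that for every $n\ge 1$: 1. $T_n$ has exactly $4\lceil\log_2 n\rceil+5$ layers; 2. for every datatype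 $\mathbb D$ of precision $q\ge c\log_2 n$, and every $u\in\Sigma^*$ such that $u\$$ has length $n$, $T_n$ on input $u\$$ (preceded by the beginning-of-sequence token) outputs some token, and that token is "accept" if and only if $u\in L$. The parameters of $T_n$ may depend on $n$ and differ from layer to layer, but $h,d,w,c$ do not depend on $n$, and $T_n$ does not depend on $\mathbb D$. -/

import Mathlib

namespace LogDepth

noncomputable section

/-! ### Numerical datatypes -/

/-- A numerical datatype: a set of representable real numbers, together with rounding of a real
number to the nearest representable number, ties being broken in favor of the higher value.
(For the values of all strings in `{0,1}^p` this is a datatype with `p` bits;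
`carrier = Set.univ` is exact real arithmetic.) -/
structure Datatype where
  carrier : Set ℝ
  round : ℝ → ℝ
  round_mem : ∀ x, round x ∈ carrier
  nearest : ∀ x, ∀ y ∈ carrier, |x - round x| ≤ |x - y|
  tie_up : ∀ x, ∀ y ∈ carrier, |x - y| = |x - round x| → y ≤ round x

/-- `D` has at least `q` bits before and `q` bits after the binary point: every fixed-point number
`k / 2 ^ q` of absolute value at most `2 ^ q` is exactly representable. -/
def Datatype.HasPrecision (D : Datatype) (q : ℕ) : Prop :=
  ∀ k : ℤ, |k| ≤ 4 ^ q → (k : ℝ) / 2 ^ q ∈ D.carrier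

/-- Dot product in the arithmetic of `D`: each product and each partial sum is rounded. -/
def Datatype.dot (D : Datatype) {k : ℕ} (x y : Fin k → ℝ) : ℝ :=
  Fin.foldl k (fun acc i => D.round (acc + D.round (x i * y i))) 0

/-- Product of a matrix of rational parameters (stored in `D`) with a vector, in the arithmetic
of `D`. -/
def Datatype.mulVec (D : Datatype) {ι : Type*} {k : ℕ} (A : Matrix ι (Fin k) ℚ)
    (x : Fin k → ℝ) : ι → ℝ :=
  fun i => D.dot (fun j => D.round (A i j : ℝ)) x

/-! ### Masked pre-norm -/

/-- The two admissible layer-norms: RMS norm and standard (centered) layer-norm. -/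
inductive NormKind where
  | rms
  | standard

/-- Division by the Euclidean norm; the zero vector is sent to itself. -/
def normalize {m : ℕ} (x : Fin m → ℝ) : Fin m → ℝ :=
  fun c => x c / Real.sqrt (∑ c', x c' ^ 2)

/-- Layer-norm, scaled so that its nonzero values have Euclidean norm one. -/
def layerNorm {m : ℕ} : NormKind → (Fin m → ℝ) → (Fin m → ℝ)
  | NormKind.rms, x => normalize x
  | NormKind.standard, x => normalize (fun c => x c - (∑ c', x c') / m)

/-- Masked pre-norm `layer_norm (mask ⊙ x)`; layer-norm is a single rounded operation. -/
def preNorm (D : Datatype) (ν : NormKind) {m : ℕ} (mask : Fin m → ℚ) (x : Fin m → ℝ) :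
    Fin m → ℝ :=
  fun c => D.round (layerNorm ν (fun c' => D.round (D.round (mask c' : ℝ) * x c')) c)

/-! ### Transformers

The model dimension is `h * d`, where `h` is the number of heads and `d` the dimension of a head;
`w` is the feedforward width. -/

structure AttentionSublayer (h d : ℕ) where
  mask : Fin (h * d) → ℚ
  Q : Fin h → Matrix (Fin d) (Fin (h * d)) ℚ
  K : Fin h → Matrix (Fin d) (Fin (h * d)) ℚ
  V : Fin h → Matrix (Fin d) (Fin (h * d)) ℚ
  W : Matrix (Fin (h * d)) (Fin (h * d)) ℚ

structure FeedforwardSublayer (h d w : ℕ) where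
  mask : Fin (h * d) → ℚ
  W : Matrix (Fin w) (Fin (h * d)) ℚ
  U : Matrix (Fin (h * d)) (Fin w) ℚ

/-- A transformer layer: a self-attention sublayer followed by a feedforward sublayer. -/
structure Layer (h d w : ℕ) where
  attention : AttentionSublayer h d
  feedforward : FeedforwardSublayer h d w

/-- A decoder-only transformer with vocabulary `V` and without positional encodings. -/
structure Transformer (V : Type*) (h d w : ℕ) where
  E : V → Fin (h * d) → ℚ
  layers : List (Layer h d w)
  U : Matrix V (Fin (h * d)) ℚ

/-- The positions `j ≤ i` at which the attention score is maximal among the positions up to `i`. -/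
def argmaxUpTo {N : ℕ} (score : Fin N → ℝ) (i : Fin N) : Finset (Fin N) :=
  open Classical in (Finset.Iic i).filter (fun j => ∀ j' ≤ i, score j' ≤ score j)

/-- Causally masked averaging-hard attention weights from position `i`: uniform on the positions
with maximal score. -/
def attentionWeight {N : ℕ} (score : Fin N → ℝ) (i j : Fin N) : ℝ :=
  open Classical in
  if j ∈ argmaxUpTo score i then 1 / ((argmaxUpTo score i).card : ℝ) else 0

/-- The output of one attention head at position `i`, with queries `q`, keys `k` and values `v`.
The sum over the positions is a single rounded operation. -/
def headOutput (D : Datatype) {N d : ℕ} (q k v : Fin N → Fin d → ℝ) (i : Fin N) : Fin d → ℝ :=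
  fun c => D.round (∑ j ∈ Finset.Iic i,
    D.round (D.round (attentionWeight (fun j' => D.dot (q i) (k j')) i j) * v j c))

/-- The self-attention sublayer, including the residual connection. -/
def AttentionSublayer.apply (D : Datatype) (ν : NormKind) {h d N : ℕ}
    (A : AttentionSublayer h d) (x : Fin N → Fin (h * d) → ℝ) : Fin N → Fin (h * d) → ℝ :=
  fun i =>
    let z : Fin N → Fin (h * d) → ℝ := fun j => preNorm D ν A.mask (x j)
    let head : Fin h → Fin d → ℝ := fun k =>
      headOutput D (fun j => D.mulVec (A.Q k) (z j)) (fun j => D.mulVec (A.K k) (z j))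
        (fun j => D.mulVec (A.V k) (z j)) i
    let concat : Fin (h * d) → ℝ := fun c =>
      head (finProdFinEquiv.symm c).1 (finProdFinEquiv.symm c).2
    fun c => D.round (x i c + D.mulVec A.W concat c)

/-- The feedforward sublayer with ReLU activation, including the residual connection. -/
def FeedforwardSublayer.apply (D : Datatype) (ν : NormKind) {h d w N : ℕ}
    (F : FeedforwardSublayer h d w) (x : Fin N → Fin (h * d) → ℝ) : Fin N → Fin (h * d) → ℝ :=
  fun i =>
    let z : Fin (h * d) → ℝ := preNorm D ν F.mask (x i)
    let hidden : Fin w → ℝ := fun b => D.round (max (D.mulVec F.W z b) 0)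
    fun c => D.round (x i c + D.mulVec F.U hidden c)

def Layer.apply (D : Datatype) (ν : NormKind) {h d w N : ℕ} (ℓ : Layer h d w)
    (x : Fin N → Fin (h * d) → ℝ) : Fin N → Fin (h * d) → ℝ :=
  ℓ.feedforward.apply D ν (ℓ.attention.apply D ν x)

/-- The residual stream after the last layer, on the token sequence `t`. -/
def Transformer.residual (D : Datatype) (ν : NormKind) {V : Type*} {h d w N : ℕ}
    (T : Transformer V h d w) (t : Fin N → V) : Fin N → Fin (h * d) → ℝ :=
  T.layers.foldl (fun x ℓ => ℓ.apply D ν x) (fun i c => D.round (T.E (t i) c : ℝ))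

/-- The logits, computed from the residual stream at the last token. -/
def Transformer.logit (D : Datatype) (ν : NormKind) {V : Type*} {h d w N : ℕ}
    (T : Transformer V h d w) (t : Fin (N + 1) → V) : V → ℝ :=
  D.mulVec T.U (T.residual D ν t (Fin.last N))

/-- On the token sequence `t` the transformer outputs the token `y`: its logit is the (unique)
maximum. -/
def Transformer.Outputs (D : Datatype) (ν : NormKind) {V : Type*} {h d w N : ℕ}
    (T : Transformer V h d w) (t : Fin (N + 1) → V) (y : V) : Prop :=
  ∀ y', y' ≠ y → T.logit D ν t y' < T.logit D ν t y

/-! ### Language recognition -/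

/-- The vocabulary: the symbols of the alphabet `α`, and, outside it, the beginning-of-sequence
token, the end token `$` and the token `accept`. -/
inductive Vocab (α : Type*) where
  | sym (a : α)
  | bos
  | dollar
  | accept

/-- The string `u$`. -/
def withDollar {α : Type*} (u : List α) : List (Vocab α) :=
  u.map Vocab.sym ++ [Vocab.dollar]

/-- On the string `u$`, preceded by the beginning-of-sequence token, `T` recognizes whether `u`
belongs to `L`: it outputs some token, and this token is `accept` if and only if `u ∈ L`. -/
def Transformer.RecognizesAt (D : Datatype) (ν : NormKind) {α : Type*} {h d w : ℕ}
    (T : Transformer (Vocab α) h d w) (L : Language α) (u : List α) : Prop :=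
  ∃ y : Vocab α,
    T.Outputs (N := (withDollar u).length) D ν ((Vocab.bos :: withDollar u).get) y ∧
      (y = Vocab.accept ↔ u ∈ L)

end

end LogDepth

namespace LogDepth

noncomputable section

/-! ### Rounding errors -/

/-! Membership of a string in a regular language depends only on the product of the actions of its
letters in a finite monoid `M` of self-maps of the states. Such products arise by recursive
doubling: if every position `i` holds the product over the window of length `2 ^ t` ending at `i`,
then multiplying by the entry at `i - 2 ^ t` doubles the window. The beginning-of-sequence token
acts as the identity, so overshooting the start is harmless (`windowProd_mul_prefixProd`), and about
`log₂ n` doublings suffice.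

Without positional encodings, a position is found by averaging the indicator of the first token,
which gives `1 / (i + 1)`; layer-norm turns `(1, 1 / (i + 1))` into the direction of `(i + 1, 1)`. A
linear map sends this to a multiple of `(i + 1 - s, 1)`, and by Cauchy-Schwarz its inner product
with the directions of the positions `j` is largest at `j = i - s`, by a margin of order `n⁻⁴`
(`position_gap`). A feedforward sublayer with one ReLU unit per pair in `M × M` then multiplies.

Features are stored in signed copies, so both layer-norms act alike, and wherever one-hot codes are
read the masks give norm `3` or `5`, which rational weights can undo.

Under rounding, each doubling layer multiplies the deviation from the ideal features by a constant
`κ ^ 18` independent of `n`: the entries of size `n` enter only the scores, whose errors are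
harmless while below half the margin. Over `O(log n)` layers the total factor is polynomial in `n`,
which precision `c log₂ n` absorbs. -/

lemma Datatype.round_eq_self (D : Datatype) {x : ℝ} (hx : x ∈ D.carrier) : D.round x = x := by
  have h := D.nearest x x hx
  simp only [sub_self, abs_zero, abs_nonpos_iff] at h
  linarith

lemma Datatype.HasPrecision.zero_mem {D : Datatype} {q : ℕ} (h : D.HasPrecision q) :
    (0 : ℝ) ∈ D.carrier := by
  simpa using h 0 (by positivity)

lemma Datatype.HasPrecision.one_mem {D : Datatype} {q : ℕ} (h : D.HasPrecision q) :
    (1 : ℝ) ∈ D.carrier := by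
  have h2 : (2 : ℤ) ^ q ≤ 4 ^ q := pow_le_pow_left₀ (by norm_num) (by norm_num) q
  have := h (2 ^ q) (by rwa [abs_of_nonneg (by positivity)])
  simpa using this

/-- Rounding down to a multiple of `1 / 2 ^ q` costs at most `1 / 2 ^ q` and stays in the guaranteed
range; the nearest element can only be closer. -/
lemma Datatype.HasPrecision.abs_round_sub_le {D : Datatype} {q : ℕ} (h : D.HasPrecision q)
    {x : ℝ} (hx : |x| ≤ 2 ^ q) : |D.round x - x| ≤ 1 / 2 ^ q := by
  have hq : (0 : ℝ) < 2 ^ q := by positivity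
  obtain ⟨h1, h2⟩ := abs_le.1 hx
  have h4 : (4 : ℝ) ^ q = 2 ^ q * 2 ^ q := by rw [← mul_pow]; norm_num
  have hmem := h ⌊x * 2 ^ q⌋ (by
    rw [abs_le]
    constructor
    · rw [Int.le_floor]; push_cast; rw [h4]; nlinarith
    · have : (⌊x * 2 ^ q⌋ : ℝ) ≤ ((4 ^ q : ℤ) : ℝ) := by
        refine (Int.floor_le _).trans ?_
        push_cast; rw [h4]; nlinarith
      exact_mod_cast this)
  have hn := D.nearest x _ hmem
  rw [abs_sub_comm]
  refine hn.trans ?_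
  have e1 := Int.floor_le (x * 2 ^ q)
  have e2 := (Int.lt_floor_add_one (x * 2 ^ q)).le
  have : x - (⌊x * 2 ^ q⌋ : ℝ) / 2 ^ q = (x * 2 ^ q - ⌊x * 2 ^ q⌋) / 2 ^ q := by
    field_simp
  rw [this, abs_of_nonneg (div_nonneg (by linarith) hq.le)]
  gcongr
  linarith

/-- Rounding in `D` fixes `0` and `1` and moves numbers of absolute value at most `ε⁻¹` by at
most `ε`. -/
structure Datatype.Approx (D : Datatype) (ε : ℝ) : Prop where
  pos : 0 < ε
  le_one : ε ≤ 1
  round_zero : D.round 0 = 0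
  round_one : D.round 1 = 1
  abs_round_sub_le : ∀ x, |x| * ε ≤ 1 → |D.round x - x| ≤ ε

lemma Datatype.HasPrecision.approx {D : Datatype} {q : ℕ} (h : D.HasPrecision q) :
    D.Approx (1 / 2 ^ q) where
  pos := by positivity
  le_one := by
    rw [div_le_one (by positivity)]
    exact one_le_pow₀ (by norm_num)
  round_zero := D.round_eq_self h.zero_mem
  round_one := D.round_eq_self h.one_mem
  abs_round_sub_le x hx := h.abs_round_sub_le (by
    rwa [mul_one_div, div_le_one (by positivity)] at hx)

section Approx

variable {D : Datatype} {ε : ℝ}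

lemma Datatype.dot_zero_left (h0 : D.round 0 = 0) {k : ℕ} (x y : Fin k → ℝ)
    (hx : ∀ i, x i * y i = 0) : D.dot x y = 0 := by
  induction k with
  | zero => simp [Datatype.dot]
  | succ k ih =>
    have := ih (fun i => x i.castSucc) (fun i => y i.castSucc) (fun i => hx _)
    simp only [Datatype.dot, Fin.foldl_succ_last] at this ⊢
    rw [this, hx, h0, add_zero, h0]

lemma Datatype.dot_single (h0 : D.round 0 = 0) {k : ℕ} (x y : Fin k → ℝ) (j : Fin k)
    (hx : ∀ i, i ≠ j → x i * y i = 0) (hj : D.round (x j * y j) = x j * y j) :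
    D.dot x y = x j * y j := by
  induction k with
  | zero => exact j.elim0
  | succ k ih =>
    induction j using Fin.lastCases with
    | last =>
      have := D.dot_zero_left h0 (fun i : Fin k => x i.castSucc) (fun i => y i.castSucc)
        (fun i => hx _ (Fin.castSucc_lt_last i).ne)
      simp only [Datatype.dot, Fin.foldl_succ_last] at this ⊢
      rw [this, hj, zero_add, hj]
    | cast j =>
      have := ih (fun i : Fin k => x i.castSucc) (fun i => y i.castSucc) j
        (fun i hi => hx _ (by simpa using hi)) hj
      simp only [Datatype.dot, Fin.foldl_succ_last] at this ⊢
      rw [this, hx _ (Fin.castSucc_lt_last j).ne', h0, add_zero, hj]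

lemma Datatype.mulVec_zero (h0 : D.round 0 = 0) {ι : Type*} {k : ℕ} (A : Matrix ι (Fin k) ℚ)
    (x : Fin k → ℝ) (i : ι) (hA : ∀ j, A i j = 0) : D.mulVec A x i = 0 := by
  refine D.dot_zero_left h0 _ _ fun j => ?_
  simp [hA, h0]

/-- Each term causes two roundings, of its product and of the partial sum. The hypothesis `hs` keeps
both within the range where a rounding costs at most `ε`. -/
lemma Datatype.Approx.abs_dot_sub_le (hD : D.Approx ε) {k : ℕ} (x y : Fin k → ℝ) {P : ℝ}
    (hP0 : 0 ≤ P) (hP : ∀ i, |x i * y i| ≤ P) (hs : k * (P + 2) * ε ≤ 1) :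
    |D.dot x y - ∑ i, x i * y i| ≤ 2 * k * ε := by
  have hε := hD.pos
  have hε1 := hD.le_one
  induction k with
  | zero => simp [Datatype.dot]
  | succ k ih =>
    push_cast at hs ⊢
    have hpos : 0 ≤ (P + 2) * ε := by positivity
    have hkε : 0 ≤ (k : ℝ) * ((P + 2) * ε) := by positivity
    have ih' := ih (fun i => x i.castSucc) (fun i => y i.castSucc) (fun i => hP _) (by linarith)
    have hS : |∑ i : Fin k, x i.castSucc * y i.castSucc| ≤ k * P := by
      refine (Finset.abs_sum_le_sum_abs _ _).trans ?_
      refine (Finset.sum_le_sum fun i _ => hP _).trans ?_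
      simp
    have hdot : D.dot x y = D.round (D.dot (fun i : Fin k => x i.castSucc)
        (fun i => y i.castSucc) + D.round (x (Fin.last k) * y (Fin.last k))) := by
      simp only [Datatype.dot, Fin.foldl_succ_last]
    rw [hdot, Fin.sum_univ_castSucc]
    set a := D.dot (fun i : Fin k => x i.castSucc) (fun i => y i.castSucc)
    set S := ∑ i : Fin k, x i.castSucc * y i.castSucc
    set p := x (Fin.last k) * y (Fin.last k)
    have hp : |p| ≤ P := hP _
    have h1 := hD.abs_round_sub_le p (by nlinarith)
    have h2 := hD.abs_round_sub_le (a + D.round p) (by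
      have : |a + D.round p| ≤ (k + 1) * (P + 2) := by
        have hk : (k : ℝ) * ε ≤ k := by
          nlinarith [(Nat.cast_nonneg k : (0 : ℝ) ≤ k)]
        rw [abs_le] at *
        constructor <;> nlinarith
      nlinarith)
    rw [abs_le] at *
    constructor <;> linarith

lemma Datatype.Approx.abs_mulVec_sub_le (hD : D.Approx ε) {ι : Type*} {k : ℕ}
    (A : Matrix ι (Fin k) ℚ) (i : ι) {z z' : Fin k → ℝ} {B η : ℝ} (hB0 : 0 ≤ B)
    (hB : ∀ j, |(A i j : ℝ)| ≤ B) (hz : ∀ j, |z j - z' j| ≤ η) (hz' : ∀ j, |z' j| ≤ 1)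
    (hεη : ε ≤ η) (hη : η ≤ 1) (hs : k * (2 * B + 4) * ε ≤ 1) :
    |D.mulVec A z i - ∑ j, (A i j : ℝ) * z' j| ≤ k * (B + 4) * η := by
  have hε := hD.pos
  have hε1 := hD.le_one
  rcases Nat.eq_zero_or_pos k with rfl | hk
  · simp [Datatype.mulVec, Datatype.dot]
  have hk1 : (1 : ℝ) ≤ k := by exact_mod_cast hk
  have hBε : (2 * B + 4) * ε ≤ 1 := by
    have : 0 ≤ (2 * B + 4) * ε := by positivity
    nlinarith
  have hA : ∀ j, |D.round (A i j : ℝ) - A i j| ≤ ε := fun j =>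
    hD.abs_round_sub_le _ (by have := hB j; nlinarith)
  have hz2 : ∀ j, |z j| ≤ 2 := fun j => by
    have h1 := hz j
    have h2 := hz' j
    rw [abs_le] at *
    constructor <;> linarith
  have hterm : ∀ j, |D.round (A i j : ℝ) * z j| ≤ 2 * B + 2 := fun j => by
    rw [abs_mul]
    have : |D.round (A i j : ℝ)| ≤ B + 1 := by
      have h1 := hA j
      have h2 := hB j
      rw [abs_le] at *
      constructor <;> linarith
    calc _ ≤ (B + 1) * 2 := mul_le_mul this (hz2 j) (abs_nonneg _) (by linarith)
      _ = _ := by ring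
  have h1 := hD.abs_dot_sub_le (fun j => D.round (A i j : ℝ)) z (P := 2 * B + 2) (by linarith)
    hterm (by linarith)
  have h2 : |∑ j, D.round (A i j : ℝ) * z j - ∑ j, (A i j : ℝ) * z' j| ≤ k * ((B + 2) * η) := by
    rw [← Finset.sum_sub_distrib]
    refine (Finset.abs_sum_le_sum_abs _ _).trans ?_
    refine (Finset.sum_le_sum (g := fun _ => (B + 2) * η) fun j _ => ?_).trans (by simp)
    have : D.round (A i j : ℝ) * z j - A i j * z' j
        = (D.round (A i j : ℝ) - A i j) * z j + A i j * (z j - z' j) := by ring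
    rw [this]
    refine (abs_add_le _ _).trans ?_
    rw [abs_mul, abs_mul]
    have e1 := mul_le_mul (hA j) (hz2 j) (abs_nonneg _) hε.le
    have e2 := mul_le_mul (hB j) (hz j) (abs_nonneg _) hB0
    nlinarith
  have h3 : |D.mulVec A z i - ∑ j, (A i j : ℝ) * z' j| ≤ 2 * k * ε + k * ((B + 2) * η) := by
    refine (abs_sub_le _ _ _).trans (add_le_add h1 h2)
  nlinarith

/-! ### Layer-norm under perturbations -/

lemma abs_sqrt_sum_sq_sub_le {m : ℕ} (a b : Fin m → ℝ) {η : ℝ} (h : ∀ c, |a c - b c| ≤ η) :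
    |√(∑ c, a c ^ 2) - √(∑ c, b c ^ 2)| ≤ m * η := by
  have h1 := abs_norm_sub_norm_le (WithLp.toLp 2 a : EuclideanSpace ℝ (Fin m)) (WithLp.toLp 2 b)
  have h2 : ‖(WithLp.toLp 2 a : EuclideanSpace ℝ (Fin m)) - WithLp.toLp 2 b‖
      ≤ ∑ c, |a c - b c| := by
    rw [EuclideanSpace.norm_eq, Real.sqrt_le_left (Finset.sum_nonneg fun c _ => abs_nonneg _)]
    simpa using Finset.sum_sq_le_sq_sum_of_nonneg (s := Finset.univ)
      (f := fun c => |a c - b c|) (fun c _ => abs_nonneg _)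
  simp only [EuclideanSpace.norm_eq, Real.norm_eq_abs, sq_abs] at h1 h2
  refine h1.trans (h2.trans ?_)
  refine (Finset.sum_le_sum fun c _ => h c).trans ?_
  simp

/-- Normalization is Lipschitz away from the origin: as `1 ≤ R`, changing the divisor costs at most
the change `m * η` of the norm, because a coordinate over its own norm is at most `1`. -/
lemma abs_normalize_sub_le {m : ℕ} (a b : Fin m → ℝ) {η R : ℝ} (h : ∀ c, |a c - b c| ≤ η)
    (hR : 1 ≤ R) (hb : ∑ c, b c ^ 2 = R ^ 2) (c : Fin m) :
    |normalize a c - b c / R| ≤ (m + 1) * η := by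
  have h1 := abs_sqrt_sum_sq_sub_le a b h
  rw [hb, Real.sqrt_sq (by linarith)] at h1
  have hη : 0 ≤ η := (abs_nonneg _).trans (h c)
  have hac : |a c| ≤ √(∑ c, a c ^ 2) := by
    refine Real.abs_le_sqrt ?_
    exact Finset.single_le_sum (f := fun c => a c ^ 2) (fun c _ => sq_nonneg _) (Finset.mem_univ c)
  unfold normalize
  set s := √(∑ c, a c ^ 2)
  have hs0 : 0 ≤ s := Real.sqrt_nonneg _
  have key : |a c / s - a c / R| ≤ m * η := by
    -- The perturbed vector might vanish; both quotients are then `0`.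
    rcases hs0.eq_or_lt with hs | hs
    · have : a c = 0 := by
        rw [← hs] at hac
        exact abs_nonpos_iff.1 hac
      rw [this]
      simp only [zero_div, sub_zero, abs_zero]
      positivity
    · have : a c / s - a c / R = (a c / s) * ((R - s) / R) := by
        field_simp
      rw [this, abs_mul, abs_div, abs_div, abs_of_pos hs, abs_of_pos (by linarith : 0 < R)]
      have e1 : |a c| / s ≤ 1 := (div_le_one hs).2 hac
      have e2 : |R - s| / R ≤ m * η := by
        rw [abs_sub_comm]
        exact (div_le_self (abs_nonneg _) hR).trans h1
      calc _ ≤ 1 * (m * η) := mul_le_mul e1 e2 (by positivity) (by norm_num)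
        _ = _ := one_mul _
  have key2 : |a c / R - b c / R| ≤ η := by
    rw [← sub_div, abs_div, abs_of_pos (by linarith : 0 < R)]
    exact (div_le_self (abs_nonneg _) hR).trans (h c)
  calc _ ≤ _ := abs_sub_le _ (a c / R) _
    _ ≤ m * η + η := add_le_add key key2
    _ = _ := by ring

/-- On vectors of mean zero the two norms coincide, and centering the perturbed vector at most
doubles its deviation. -/
lemma abs_layerNorm_sub_le (ν : NormKind) {m : ℕ} (a b : Fin m → ℝ) {η R : ℝ}
    (h : ∀ c, |a c - b c| ≤ η) (hR : 1 ≤ R) (hb : ∑ c, b c ^ 2 = R ^ 2) (hb0 : ∑ c, b c = 0)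
    (c : Fin m) : |layerNorm ν a c - b c / R| ≤ (m + 1) * (2 * η) := by
  have hη : 0 ≤ η := (abs_nonneg _).trans (h c)
  cases ν with
  | rms =>
    refine abs_normalize_sub_le a b (fun c => (h c).trans ?_) hR hb c
    linarith
  | standard =>
    refine abs_normalize_sub_le (fun c => a c - (∑ c', a c') / m) b (η := 2 * η) (fun c => ?_)
      hR hb c
    have hm : (0 : ℝ) < m := by exact_mod_cast c.pos
    have hmean : |(∑ c', a c') / m| ≤ η := by
      rw [abs_div, abs_of_pos hm, div_le_iff₀ hm, ← sub_zero (∑ c', a c'), ← hb0,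
        ← Finset.sum_sub_distrib]
      refine (Finset.abs_sum_le_sum_abs _ _).trans ?_
      refine (Finset.sum_le_sum fun c _ => h c).trans ?_
      simp [mul_comm]
    have := h c
    rw [abs_le] at *
    constructor <;> linarith

lemma Datatype.Approx.abs_preNorm_sub_le (hD : D.Approx ε) (ν : NormKind) {m : ℕ}
    (mask : Fin m → ℚ) {x x' : Fin m → ℝ} {η B R : ℝ} (hB0 : 0 ≤ B)
    (hB : ∀ c, |(mask c : ℝ)| ≤ B) (hx : ∀ c, |x c - x' c| ≤ η) (hx' : ∀ c, |x' c| ≤ 1)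
    (hεη : ε ≤ η) (hη : η ≤ 1) (hs : (2 * B + 2) * ε ≤ 1)
    (hs' : (1 + (m + 1) * (2 * ((B + 3) * η))) * ε ≤ 1) (hR : 1 ≤ R)
    (hsum : ∑ c, (mask c * x' c : ℝ) = 0) (hsq : ∑ c, (mask c * x' c : ℝ) ^ 2 = R ^ 2)
    (c : Fin m) :
    |preNorm D ν mask x c - mask c * x' c / R| ≤ (m + 1) * (2 * ((B + 3) * η)) + η := by
  have hε := hD.pos
  have hε1 := hD.le_one
  have hu : ∀ c, |D.round (D.round (mask c : ℝ) * x c) - mask c * x' c| ≤ (B + 3) * η := by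
    intro c
    have h0 := hB c
    have h1 := hD.abs_round_sub_le (mask c : ℝ) (by nlinarith)
    have hx2 : |x c| ≤ 2 := by
      have h1 := hx c
      have h2 := hx' c
      rw [abs_le] at *
      constructor <;> linarith
    have hm : |D.round (mask c : ℝ)| ≤ B + 1 := by
      rw [abs_le] at *
      constructor <;> linarith
    have h2 := hD.abs_round_sub_le (D.round (mask c : ℝ) * x c) (by
      rw [abs_mul]
      have := mul_le_mul hm hx2 (abs_nonneg _) (by linarith)
      nlinarith)
    have h3 : |D.round (mask c : ℝ) * x c - mask c * x' c| ≤ 2 * ε + B * η := by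
      have : D.round (mask c : ℝ) * x c - mask c * x' c
          = (D.round (mask c : ℝ) - mask c) * x c + mask c * (x c - x' c) := by ring
      rw [this]
      refine (abs_add_le _ _).trans ?_
      rw [abs_mul, abs_mul]
      have e1 := mul_le_mul h1 hx2 (abs_nonneg _) hε.le
      have e2 := mul_le_mul h0 (hx c) (abs_nonneg _) hB0
      nlinarith
    refine (abs_sub_le _ _ _).trans ((add_le_add h2 h3).trans ?_)
    nlinarith
  have h1 := abs_layerNorm_sub_le ν _ (fun c => (mask c * x' c : ℝ)) hu hR hsq hsum c
  have hz1 : |(mask c * x' c / R : ℝ)| ≤ 1 := by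
    rw [abs_div, abs_of_pos (by linarith : 0 < R), div_le_one (by linarith)]
    refine abs_le_of_sq_le_sq ?_ (by linarith)
    rw [← hsq]
    exact Finset.single_le_sum (f := fun c => (mask c * x' c : ℝ) ^ 2)
      (fun c _ => sq_nonneg _) (Finset.mem_univ c)
  unfold preNorm
  set l := layerNorm ν (fun c' => D.round (D.round (mask c' : ℝ) * x c')) c
  have h2 := hD.abs_round_sub_le l (by
    have : |l| ≤ 1 + (m + 1) * (2 * ((B + 3) * η)) := by
      rw [abs_le] at *
      constructor <;> linarith
    nlinarith)
  refine (abs_sub_le _ _ _).trans ((add_le_add h2 h1).trans ?_)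
  linarith

end Approx

/-! ### Sublayers acting on signed copies of a feature vector

The residual stream stores four copies of a feature vector, with alternating signs, so that
its mean vanishes and both layer-norms divide it by twice the norm of the feature vector. -/

section Features

variable {Φ : Type*} {d : ℕ}

/-- The coordinates of the residual stream of a transformer with one head, as signed copies of
features. -/
def coord (e : Fin d ≃ Fin 4 × Φ) : Fin (1 * d) ≃ Fin 4 × Φ :=
  finProdFinEquiv.symm.trans ((Equiv.uniqueProd (Fin d) (Fin 1)).trans e)

/-- The sign of a copy. -/
def copySign (s : Fin 4) : ℚ := (-1) ^ (s : ℕ)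

lemma abs_copySign (s : Fin 4) : |(copySign s : ℝ)| = 1 := by
  simp [copySign]

lemma copySign_zero : copySign 0 = 1 := by simp [copySign]

/-- The residual stream that represents the feature vector `v`. -/
def lift (e : Fin d ≃ Fin 4 × Φ) (v : Φ → ℝ) (c : Fin (1 * d)) : ℝ :=
  copySign (coord e c).1 * v (coord e c).2

lemma abs_lift (e : Fin d ≃ Fin 4 × Φ) (v : Φ → ℝ) (c : Fin (1 * d)) :
    |lift e v c| = |v (coord e c).2| := by
  rw [lift, abs_mul, abs_copySign, one_mul]

/-- The linear form that evaluates `a` on the first copy of the features. -/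
def readRow (e : Fin d ≃ Fin 4 × Φ) (a : Φ → ℚ) (c : Fin (1 * d)) : ℚ :=
  if (coord e c).1 = 0 then a (coord e c).2 else 0

lemma abs_readRow_le (e : Fin d ≃ Fin 4 × Φ) {a : Φ → ℚ} {B : ℝ} (hB0 : 0 ≤ B)
    (ha : ∀ k, |(a k : ℝ)| ≤ B) (c : Fin (1 * d)) : |(readRow e a c : ℝ)| ≤ B := by
  unfold readRow
  split_ifs
  · exact ha _
  · simpa using hB0

variable [Fintype Φ]

lemma sum_coord (e : Fin d ≃ Fin 4 × Φ) (f : Fin 4 → Φ → ℝ) :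
    ∑ c, f (coord e c).1 (coord e c).2 = ∑ s, ∑ k, f s k := by
  rw [← Fintype.sum_prod_type']
  exact Equiv.sum_comp (coord e) (fun p => f p.1 p.2)

lemma sum_readRow (e : Fin d ≃ Fin 4 × Φ) (a : Φ → ℚ) (g : Fin 4 → Φ → ℝ) :
    ∑ c, (readRow e a c : ℝ) * g (coord e c).1 (coord e c).2 = ∑ k, (a k : ℝ) * g 0 k := by
  have := sum_coord e (fun s k => ((if s = 0 then a k else 0 : ℚ) : ℝ) * g s k)
  simp only [readRow]
  rw [this, Finset.sum_eq_single 0]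
  · simp
  · intro s _ hs
    simp [hs]
  · simp

lemma sum_readRow_lift (e : Fin d ≃ Fin 4 × Φ) (a : Φ → ℚ) (z : Φ → ℝ) :
    ∑ c, (readRow e a c : ℝ) * lift e z c = ∑ k, (a k : ℝ) * z k := by
  have := sum_readRow e a (fun s k => copySign s * z k)
  simpa [lift, copySign_zero] using this

/-- The feature vector read by a sublayer, when the masked feature vector has norm `R`. -/
def maskedFeatures (mask : Φ → ℚ) (R : ℝ) (v : Φ → ℝ) (k : Φ) : ℝ := mask k * v k / (2 * R)

lemma abs_maskedFeatures_le {mask : Φ → ℚ} {R : ℝ} {v : Φ → ℝ} (hR : 1 ≤ R)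
    (h : ∑ k, (mask k * v k : ℝ) ^ 2 = R ^ 2) (k : Φ) : |maskedFeatures mask R v k| ≤ 1 := by
  rw [maskedFeatures, abs_div, abs_of_pos (by linarith : 0 < 2 * R), div_le_one (by linarith)]
  have : |(mask k * v k : ℝ)| ≤ R := by
    refine abs_le_of_sq_le_sq ?_ (by linarith)
    rw [← h]
    exact Finset.single_le_sum (f := fun k => (mask k * v k : ℝ) ^ 2)
      (fun c _ => sq_nonneg _) (Finset.mem_univ k)
  linarith

variable {D : Datatype} {ε κ η : ℝ}

/-- Alternating signs make the mean vanish, and four copies multiply the norm by the rational number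
`2`. From here on `κ` bounds the dimensions and is at least `8`, so that numerical constants are
absorbed into its powers. -/
lemma Datatype.Approx.abs_preNorm_lift_sub_le (hD : D.Approx ε) (ν : NormKind)
    (e : Fin d ≃ Fin 4 × Φ) (hκ : 8 ≤ κ) (hd : d ≤ κ) {mask : Φ → ℚ}
    (hmask : ∀ k, |(mask k : ℝ)| ≤ 4) {v : Φ → ℝ} (hv : ∀ k, |v k| ≤ 1) {R : ℝ} (hR : 1 ≤ R)
    (hsq : ∑ k, (mask k * v k : ℝ) ^ 2 = R ^ 2) {x : Fin (1 * d) → ℝ}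
    (hx : ∀ c, |x c - lift e v c| ≤ η) (hεη : ε ≤ η) (hη : κ ^ 3 * η ≤ 1) (c : Fin (1 * d)) :
    |preNorm D ν (fun c => mask (coord e c).2) x c - lift e (maskedFeatures mask R v) c|
      ≤ κ ^ 3 * η := by
  have hε := hD.pos
  have hη0 : 0 < η := hε.trans_le hεη
  have hκ2 : 64 ≤ κ ^ 2 := by nlinarith
  have hκ3 : 64 * κ ≤ κ ^ 3 := by nlinarith
  have hη512 : 512 * η ≤ 1 := by nlinarith
  have hm : (((1 * d : ℕ) : ℝ)) ≤ κ := by simpa using hd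
  have hlin : (((1 * d : ℕ) : ℝ) + 1) * (2 * ((4 + 3) * η)) + η ≤ κ ^ 3 * η := by
    have : (((1 * d : ℕ) : ℝ) + 1) * (2 * (4 + 3)) + 1 ≤ κ ^ 3 := by nlinarith
    nlinarith
  refine le_trans ?_ hlin
  have hmain := hD.abs_preNorm_sub_le ν (fun c => mask (coord e c).2) (x := x) (x' := lift e v)
    (η := η) (B := 4) (R := 2 * R) (by norm_num) (fun c => hmask _) hx
    (fun c => by rw [abs_lift]; exact hv _) hεη (by linarith) (by linarith)
    (by
      have : 1 + (((1 * d : ℕ) : ℝ) + 1) * (2 * ((4 + 3) * η)) ≤ 2 := by linarith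
      nlinarith) (by linarith)
    (by
      have := sum_coord e (fun s k => (mask k : ℝ) * (copySign s * v k))
      simp only [lift]
      rw [this, Finset.sum_comm]
      refine Finset.sum_eq_zero fun k _ => ?_
      rw [Fin.sum_univ_four]
      simp [copySign]
      ring_nf)
    (by
      have := sum_coord e (fun s k => ((mask k : ℝ) * (copySign s * v k)) ^ 2)
      simp only [lift]
      rw [this, Fin.sum_univ_four, mul_pow, ← hsq]
      simp [copySign]
      ring_nf) c
  have heq : lift e (maskedFeatures mask R v) c
      = mask (coord e c).2 * lift e v c / (2 * R) := by
    simp only [lift, maskedFeatures]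
    ring
  rw [heq]
  exact hmain

/-! ### Feedforward sublayers -/

/-- The feedforward sublayer that adds `U * ReLU (A * z)` to the features. -/
def featureFeedforward {H : Type*} {w : ℕ} (e : Fin d ≃ Fin 4 × Φ) (eH : Fin w ≃ H)
    (mask : Φ → ℚ) (A : Matrix H Φ ℚ) (U : Matrix Φ H ℚ) : FeedforwardSublayer 1 d w where
  mask c := mask (coord e c).2
  W b := readRow e (A (eH b))
  U c b := copySign (coord e c).1 * U (coord e c).2 (eH b)

/-- The last step of both kinds of sublayer: output matrix, residual connection and final rounding.
-/
lemma Datatype.Approx.abs_add_mulVec_sub_le (hD : D.Approx ε) {m k : ℕ} (hκ : 8 ≤ κ) (hk : k ≤ κ)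
    (A : Matrix (Fin m) (Fin k) ℚ) (c : Fin m) (hA : ∀ j, |(A c j : ℝ)| ≤ 4)
    {z z' : Fin k → ℝ} {a a' b θ : ℝ} (hz : ∀ j, |z j - z' j| ≤ θ) (hz' : ∀ j, |z' j| ≤ 1)
    (ha : |a - a'| ≤ θ) (hb : a' + ∑ j, (A c j : ℝ) * z' j = b) (hb1 : |b| ≤ 1)
    (hεθ : ε ≤ θ) (hθ : κ ^ 3 * θ ≤ 1) :
    |D.round (a + D.mulVec A z c) - b| ≤ κ ^ 3 * θ := by
  have hε := hD.pos
  have hθ0 : 0 < θ := hε.trans_le hεθ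
  have hκ2 : 64 ≤ κ ^ 2 := by nlinarith
  have hκ3 : 64 * κ ≤ κ ^ 3 := by nlinarith
  have hθ1 : 512 * θ ≤ 1 := by nlinarith
  have h1 := hD.abs_mulVec_sub_le A c (B := 4) (by norm_num) hA hz hz' hεθ (by linarith)
    (by
      have : (k : ℝ) * (2 * 4 + 4) ≤ κ ^ 3 := by nlinarith
      nlinarith)
  have h2 : (k : ℝ) * (4 + 4) * θ ≤ κ ^ 2 * θ := by
    have : (k : ℝ) * (4 + 4) ≤ κ ^ 2 := by nlinarith
    nlinarith
  have h3 : |a + D.mulVec A z c - b| ≤ (κ ^ 2 + 1) * θ := by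
    rw [← hb]
    rw [abs_le] at *
    constructor <;> linarith
  have h5 : (κ ^ 2 + 2) * θ ≤ κ ^ 3 * θ := by
    have : κ ^ 2 + 2 ≤ κ ^ 3 := by nlinarith
    nlinarith
  have h4 := hD.abs_round_sub_le (a + D.mulVec A z c) (by
    have : |a + D.mulVec A z c| ≤ 2 := by
      rw [abs_le] at *
      constructor <;> linarith
    nlinarith)
  refine (abs_sub_le _ _ _).trans ((add_le_add h4 h3).trans ?_)
  linarith

/-- Pre-norm, hidden layer and output each cost a factor `κ ^ 3`; ReLU does not enlarge errors. -/
lemma Datatype.Approx.abs_feedforward_sub_le (hD : D.Approx ε) (ν : NormKind) {H : Type*}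
    [Fintype H] {w N : ℕ} (e : Fin d ≃ Fin 4 × Φ) (eH : Fin w ≃ H) (hκ : 8 ≤ κ) (hd : d ≤ κ)
    (hw : w ≤ κ) {mask : Φ → ℚ} (hmask : ∀ k, |(mask k : ℝ)| ≤ 4)
    {A : Matrix H Φ ℚ} (hA : ∀ b k, |(A b k : ℝ)| ≤ 4)
    {U : Matrix Φ H ℚ} (hU : ∀ k b, |(U k b : ℝ)| ≤ 4)
    {v : Φ → ℝ} (hv : ∀ k, |v k| ≤ 1) {R : ℝ} (hR : 1 ≤ R)
    (hsq : ∑ k, (mask k * v k : ℝ) ^ 2 = R ^ 2) {g : H → ℝ}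
    (hg : ∀ b, max (∑ k, (A b k : ℝ) * maskedFeatures mask R v k) 0 = g b) (hg1 : ∀ b, g b ≤ 1)
    {v' : Φ → ℝ} (hv' : ∀ k, |v' k| ≤ 1) (hout : ∀ k, v k + ∑ b, (U k b : ℝ) * g b = v' k)
    {x : Fin N → Fin (1 * d) → ℝ} (i : Fin N)
    (hx : ∀ c, |x i c - lift e v c| ≤ η) (hεη : ε ≤ η) (hη : κ ^ 9 * η ≤ 1) (c : Fin (1 * d)) :
    |(featureFeedforward e eH mask A U).apply D ν x i c - lift e v' c| ≤ κ ^ 9 * η := by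
  have hε := hD.pos
  have hη0 : 0 < η := hε.trans_le hεη
  have hκ1 : 1 ≤ κ := by linarith
  have hmono : ∀ a b : ℕ, a ≤ b → κ ^ a * η ≤ κ ^ b * η := fun a b hab =>
    mul_le_mul_of_nonneg_right (pow_le_pow_right₀ hκ1 hab) hη0.le
  have hεp : ∀ a : ℕ, ε ≤ κ ^ a * η := fun a => hεη.trans (by simpa using hmono 0 a a.zero_le)
  have hz := hD.abs_preNorm_lift_sub_le ν e hκ hd hmask hv hR hsq hx hεη
    ((hmono 3 9 (by norm_num)).trans hη)
  have hκ2 : 64 ≤ κ ^ 2 := by nlinarith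
  have hh : ∀ b, |D.round (max (D.mulVec (fun b => readRow e (A (eH b)))
      (preNorm D ν (fun c => mask (coord e c).2) (x i)) b) 0) - g (eH b)| ≤ κ ^ 6 * η := by
    intro b
    have h1 := hD.abs_mulVec_sub_le (fun b => readRow e (A (eH b))) b (B := 4) (by norm_num)
      (abs_readRow_le e (by norm_num) (hA _)) hz
      (fun c => by rw [abs_lift]; exact abs_maskedFeatures_le hR hsq _) (hεp 3)
      ((hmono 3 9 (by norm_num)).trans hη)
      (by
        have h8 : κ ^ 3 * η ≤ 1 := (hmono 3 9 (by norm_num)).trans hη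
        have : (((1 * d : ℕ) : ℝ)) * (2 * 4 + 4) ≤ κ ^ 3 := by
          push_cast
          nlinarith
        nlinarith)
    rw [sum_readRow_lift] at h1
    have h2 := abs_max_sub_max_le_abs
      (D.mulVec (fun b => readRow e (A (eH b))) (preNorm D ν (fun c => mask (coord e c).2) (x i)) b)
      (∑ k, (A (eH b) k : ℝ) * maskedFeatures mask R v k) 0
    rw [hg] at h2
    have h3 : (((1 * d : ℕ) : ℝ)) * (4 + 4) * (κ ^ 3 * η) ≤ κ ^ 5 * η := by
      have : (((1 * d : ℕ) : ℝ)) * (4 + 4) ≤ κ ^ 2 := by push_cast; nlinarith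
      calc _ ≤ κ ^ 2 * (κ ^ 3 * η) := mul_le_mul_of_nonneg_right this (by positivity)
        _ = _ := by ring
    have h4 := h2.trans (h1.trans h3)
    have hg0 : 0 ≤ g (eH b) := hg (eH b) ▸ le_max_right _ _
    have h6 : κ ^ 5 * η ≤ 1 := (hmono 5 9 (by norm_num)).trans hη
    have h5 := hD.abs_round_sub_le (max (D.mulVec (fun b => readRow e (A (eH b)))
      (preNorm D ν (fun c => mask (coord e c).2) (x i)) b) 0) (by
        have : |max (D.mulVec (fun b => readRow e (A (eH b)))
          (preNorm D ν (fun c => mask (coord e c).2) (x i)) b) 0| ≤ 2 := by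
          have := hg1 (eH b)
          rw [abs_le] at *
          constructor <;> linarith
        have h7 : κ ^ 1 * η ≤ 1 := (hmono 1 9 (by norm_num)).trans hη
        nlinarith)
    refine (abs_sub_le _ _ _).trans ((add_le_add h5 h4).trans ?_)
    have h7 : κ ^ 6 * η = κ * (κ ^ 5 * η) := by ring
    have h8 := hεp 5
    nlinarith [hmono 0 5 (by norm_num)]
  have hfin := hD.abs_add_mulVec_sub_le hκ hw
    (fun c b => copySign (coord e c).1 * U (coord e c).2 (eH b)) c
    (fun b => by
      push_cast
      rw [abs_mul, abs_copySign, one_mul]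
      exact hU _ _) hh
    (fun b => by
      rw [← hg, abs_of_nonneg (le_max_right _ _), hg]
      exact hg1 _)
    ((hx c).trans (by simpa using hmono 0 6 (by norm_num)))
    (b := lift e v' c)
    (by
      simp only [lift, ← hout, mul_add, Finset.mul_sum]
      congr 1
      rw [← Equiv.sum_comp eH]
      refine Finset.sum_congr rfl fun b _ => ?_
      push_cast
      ring) (by rw [abs_lift]; exact hv' _) (hεp 6)
    (by rw [← mul_assoc, ← pow_add]; exact hη)
  rw [← mul_assoc, ← pow_add] at hfin
  exact hfin

/-! ### Attention sublayers -/

/-- The attention sublayer that adds `B * z'` to the features, where `z'` is the average of the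
normalized features `z j` over the positions `j` that maximize `⟨Q * z i, z j⟩`. -/
def featureAttention [DecidableEq Φ] (e : Fin d ≃ Fin 4 × Φ) (mask : Φ → ℚ) (Q B : Matrix Φ Φ ℚ) :
    AttentionSublayer 1 d where
  mask c := mask (coord e c).2
  Q _ j := readRow e (Q (e j).2)
  K _ j := readRow e ((1 : Matrix Φ Φ ℚ) (e j).2)
  V _ j := readRow e ((1 : Matrix Φ Φ ℚ) (e j).2)
  W c c' := copySign (coord e c).1 * readRow e (B (coord e c).2) c'

lemma argmaxUpTo_eq_singleton {N : ℕ} {score : Fin N → ℝ} {i j : Fin N} (hj : j ≤ i)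
    (h : ∀ j' ≤ i, j' ≠ j → score j' < score j) : argmaxUpTo score i = {j} := by
  ext j'
  simp only [argmaxUpTo, Finset.mem_filter, Finset.mem_Iic, Finset.mem_singleton]
  constructor
  · rintro ⟨h1, h2⟩
    by_contra hne
    exact (h j' h1 hne).not_ge (h2 j hj)
  · rintro rfl
    exact ⟨hj, fun j'' h'' => by
      by_cases hne : j'' = j'
      · rw [hne]
      · exact (h j'' h'' hne).le⟩

lemma argmaxUpTo_const {N : ℕ} {score : Fin N → ℝ} (h : ∀ j j', score j = score j') (i : Fin N) :
    argmaxUpTo score i = Finset.Iic i := by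
  ext j
  simp only [argmaxUpTo, Finset.mem_filter, Finset.mem_Iic, and_iff_left_iff_imp]
  exact fun _ j' _ => (h j' j).le

/-- A strict maximizer has weight exactly `1` and all other terms are exactly `0`, so the error does
not depend on the number of positions. -/
lemma Datatype.Approx.abs_headOutput_sub_le_of_unique (hD : D.Approx ε) {N d : ℕ}
    {q k v : Fin N → Fin d → ℝ} {i j : Fin N} (hj : j ≤ i)
    (h : ∀ j' ≤ i, j' ≠ j → D.dot (q i) (k j') < D.dot (q i) (k j)) {c : Fin d} {a θ : ℝ}
    (hv : |v j c - a| ≤ θ) (ha : |a| ≤ 1) (hθ : θ ≤ 1) (hε : 4 * ε ≤ 1) :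
    |headOutput D q k v i c - a| ≤ θ + 2 * ε := by
  have hpos := hD.pos
  have hsum : headOutput D q k v i c = D.round (D.round (v j c)) := by
    unfold headOutput
    rw [Finset.sum_eq_single_of_mem j (Finset.mem_Iic.2 hj)]
    · simp [attentionWeight, argmaxUpTo_eq_singleton (score := fun j' => D.dot (q i) (k j')) hj h,
        hD.round_one]
    · intro j' _ hne
      simp [attentionWeight, argmaxUpTo_eq_singleton (score := fun j' => D.dot (q i) (k j')) hj h,
        hne, hD.round_zero]
  rw [hsum]
  have h1 := hD.abs_round_sub_le (v j c) (by
    have : |v j c| ≤ 2 := by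
      rw [abs_le] at *
      constructor <;> linarith
    nlinarith)
  rw [D.round_eq_self (D.round_mem _)]
  rw [abs_le] at *
  constructor <;> linarith

/-- Here every position contributes its own rounding errors, so the bound grows with `N`. This is
affordable because only one layer averages. -/
lemma Datatype.Approx.abs_headOutput_sub_le_of_const (hD : D.Approx ε) {N d : ℕ}
    {q k v : Fin N → Fin d → ℝ} {i : Fin N}
    (h : ∀ j j', D.dot (q i) (k j) = D.dot (q i) (k j')) {c : Fin d} {a : Fin N → ℝ} {θ : ℝ}
    (hv : ∀ j, |v j c - a j| ≤ θ) (ha : ∀ j, |a j| ≤ 1) (hθ : θ ≤ 1)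
    (hε : 4 * (N + 1) * ε ≤ 1) :
    |headOutput D q k v i c - (∑ j ∈ Finset.Iic i, a j) / (i + 1)| ≤ θ + (4 * N + 1) * ε := by
  have hpos := hD.pos
  have hN : (1 : ℝ) ≤ N := by exact_mod_cast i.pos
  have hε4 : 4 * ε ≤ 1 := by nlinarith
  have hi1 : (0 : ℝ) < (i : ℝ) + 1 := by positivity
  have hcard : ((Finset.Iic i).card : ℝ) = i + 1 := by simp
  have hiN : (i : ℝ) + 1 ≤ N := by exact_mod_cast i.isLt
  set w : ℝ := 1 / ((i : ℝ) + 1) with hw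
  have hw0 : 0 ≤ w := by positivity
  have hw1 : w ≤ 1 := by
    rw [hw, div_le_one hi1]
    linarith [(Nat.cast_nonneg (i : ℕ) : (0 : ℝ) ≤ (i : ℕ))]
  have hwi : ((i : ℝ) + 1) * w = 1 := by rw [hw]; field_simp
  have hrw := hD.abs_round_sub_le w (by rw [abs_of_nonneg hw0]; nlinarith)
  have hwt : ∀ j ∈ Finset.Iic i,
      attentionWeight (fun j' => D.dot (q i) (k j')) i j = w := by
    intro j hj
    rw [attentionWeight, argmaxUpTo_const h, if_pos hj, hcard]
  have hterm : ∀ j, |D.round (D.round w * v j c) - w * a j| ≤ w * θ + 3 * ε := by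
    intro j
    have hv2 : |v j c| ≤ 2 := by
      have h1 := hv j
      have h2 := ha j
      rw [abs_le] at *
      constructor <;> linarith
    have hrw2 : |D.round w| ≤ 2 := by
      rw [abs_le] at *
      constructor <;> linarith
    have h1 := hD.abs_round_sub_le (D.round w * v j c) (by
      rw [abs_mul]
      have := mul_le_mul hrw2 hv2 (abs_nonneg _) (by norm_num)
      nlinarith)
    have h2 : |D.round w * v j c - w * a j| ≤ ε * 2 + w * θ := by
      have : D.round w * v j c - w * a j = (D.round w - w) * v j c + w * (v j c - a j) := by ring
      rw [this]
      refine (abs_add_le _ _).trans ?_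
      rw [abs_mul, abs_mul, abs_of_nonneg hw0]
      exact add_le_add (mul_le_mul hrw hv2 (abs_nonneg _) hpos.le)
        (mul_le_mul_of_nonneg_left (hv j) hw0)
    refine (abs_sub_le _ _ _).trans ((add_le_add h1 h2).trans ?_)
    linarith
  have hsum : |∑ j ∈ Finset.Iic i, D.round (D.round
      (attentionWeight (fun j' => D.dot (q i) (k j')) i j) * v j c)
      - (∑ j ∈ Finset.Iic i, a j) / (i + 1)| ≤ θ + 3 * N * ε := by
    have : (∑ j ∈ Finset.Iic i, a j) / ((i : ℝ) + 1) = ∑ j ∈ Finset.Iic i, w * a j := by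
      rw [← Finset.mul_sum, hw]
      ring
    rw [this, ← Finset.sum_sub_distrib]
    refine (Finset.abs_sum_le_sum_abs _ _).trans ?_
    refine (Finset.sum_le_sum (g := fun _ => w * θ + 3 * ε) fun j hj => ?_).trans ?_
    · rw [hwt j hj]
      exact hterm j
    · rw [Finset.sum_const, nsmul_eq_mul, hcard, mul_add, ← mul_assoc, hwi]
      nlinarith
  have havg : |(∑ j ∈ Finset.Iic i, a j) / ((i : ℝ) + 1)| ≤ 1 := by
    rw [abs_div, abs_of_pos hi1, div_le_one hi1]
    refine (Finset.abs_sum_le_sum_abs _ _).trans ?_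
    refine (Finset.sum_le_sum fun j _ => ha j).trans ?_
    simp
  have hfin := hD.abs_round_sub_le (∑ j ∈ Finset.Iic i, D.round (D.round
      (attentionWeight (fun j' => D.dot (q i) (k j')) i j) * v j c)) (by
    have : |∑ j ∈ Finset.Iic i, D.round (D.round
      (attentionWeight (fun j' => D.dot (q i) (k j')) i j) * v j c)| ≤ 3 := by
      rw [abs_le] at *
      constructor <;> nlinarith
    nlinarith)
  unfold headOutput
  refine (abs_sub_le _ _ _).trans ((add_le_add hfin hsum).trans ?_)
  nlinarith

variable [DecidableEq Φ]

/-- The part common to selecting and averaging heads, given a bound on the head outputs. -/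
lemma Datatype.Approx.abs_attention_sub_le (hD : D.Approx ε) (ν : NormKind) {N : ℕ}
    (e : Fin d ≃ Fin 4 × Φ) (hκ : 8 ≤ κ) (hd : d ≤ κ) {mask : Φ → ℚ}
    {Q B : Matrix Φ Φ ℚ} (hB : ∀ k k', |(B k k' : ℝ)| ≤ 4)
    {x : Fin N → Fin (1 * d) → ℝ} (i : Fin N) {v v' a : Φ → ℝ} {θ : ℝ}
    (hx : ∀ c, |x i c - lift e v c| ≤ θ)
    (hhead : ∀ j, |headOutput D
      (fun j => D.mulVec (fun j => readRow e (Q (e j).2))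
        (preNorm D ν (fun c => mask (coord e c).2) (x j)))
      (fun j => D.mulVec (fun j => readRow e ((1 : Matrix Φ Φ ℚ) (e j).2))
        (preNorm D ν (fun c => mask (coord e c).2) (x j)))
      (fun j => D.mulVec (fun j => readRow e ((1 : Matrix Φ Φ ℚ) (e j).2))
        (preNorm D ν (fun c => mask (coord e c).2) (x j))) i j - a (e j).2| ≤ θ)
    (ha : ∀ k, |a k| ≤ 1) (hv' : ∀ k, |v' k| ≤ 1)
    (hout : ∀ k, v k + ∑ k', (B k k' : ℝ) * a k' = v' k)
    (hεθ : ε ≤ θ) (hθ : κ ^ 3 * θ ≤ 1) (c : Fin (1 * d)) :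
    |(featureAttention e mask Q B).apply D ν x i c - lift e v' c| ≤ κ ^ 3 * θ := by
  refine hD.abs_add_mulVec_sub_le (k := 1 * d) hκ (by simpa using hd) _ c
    (z' := fun c' => a (coord e c').2) (fun j => ?_) (fun j => hhead _) (fun _ => ha _) (hx c)
    ?_ (by rw [abs_lift]; exact hv' _) hεθ hθ
  · simp only [featureAttention]
    push_cast
    rw [abs_mul, abs_copySign, one_mul]
    exact abs_readRow_le e (by norm_num) (hB _) _
  · simp only [lift, ← hout, mul_add]
    congr 1
    rw [← sum_readRow e (B (coord e c).2) (fun _ k => a k), Finset.mul_sum]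
    refine Finset.sum_congr rfl fun c' _ => ?_
    simp only [featureAttention]
    push_cast
    ring

end Features

/-! ### Error bounds for selecting and averaging heads. -/

section Heads

variable {Φ : Type*} [Fintype Φ] {d : ℕ} {D : Datatype} {ε κ η : ℝ}

/-- The bound `n` on the entries, needed for the shift in the query, is kept apart from `κ` so that
its effect can be confined to the scores. -/
lemma Datatype.Approx.abs_mulVec_readRow_sub_le (hD : D.Approx ε) (e : Fin d ≃ Fin 4 × Φ)
    (hκ : 8 ≤ κ) (hd : d ≤ κ) {Q : Matrix Φ Φ ℚ} {n θ : ℝ} (hn : 1 ≤ n)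
    (hQ : ∀ k k', |(Q k k' : ℝ)| ≤ n) {y : Fin (1 * d) → ℝ} {z : Φ → ℝ}
    (hy : ∀ c, |y c - lift e z c| ≤ θ) (hz : ∀ k, |z k| ≤ 1) (hεθ : ε ≤ θ)
    (hθ : n * κ ^ 2 * θ ≤ 1) (j : Fin d) :
    |D.mulVec (fun j => readRow e (Q (e j).2)) y j - ∑ k, (Q (e j).2 k : ℝ) * z k|
      ≤ n * κ ^ 2 * θ := by
  have hε := hD.pos
  have hθ0 : 0 < θ := hε.trans_le hεθ
  have hm : (((1 * d : ℕ) : ℝ)) ≤ κ := by simpa using hd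
  have h64 : 64 ≤ κ ^ 2 := by nlinarith
  have hnκ : n + 4 ≤ n * κ := by nlinarith
  have hnκ' : 2 * n + 4 ≤ n * κ := by nlinarith
  have hnκ0 : 0 ≤ n * κ := by positivity
  have hmul : ∀ t : ℝ, 0 ≤ t → t ≤ n * κ → (((1 * d : ℕ) : ℝ)) * t ≤ n * κ ^ 2 := fun t h0 h =>
    calc _ ≤ κ * (n * κ) := mul_le_mul hm h h0 (by linarith)
      _ = _ := by ring
  have h1 := hD.abs_mulVec_sub_le (fun j => readRow e (Q (e j).2)) j (B := n) (by linarith)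
    (abs_readRow_le e (by linarith) (hQ _)) hy (fun c => by rw [abs_lift]; exact hz _) hεθ
    ((le_mul_of_one_le_left hθ0.le (one_le_mul_of_one_le_of_one_le hn (by linarith))).trans hθ)
    (by
      have := hmul (2 * n + 4) (by linarith) hnκ'
      have h2 : n * κ ^ 2 * ε ≤ n * κ ^ 2 * θ := by gcongr
      have h3 := mul_le_mul_of_nonneg_right this hε.le
      linarith)
  rw [sum_readRow_lift] at h1
  exact h1.trans (mul_le_mul_of_nonneg_right (hmul _ (by linarith) hnκ) hθ0.le)

variable [DecidableEq Φ]

lemma sum_one_mul (z : Φ → ℝ) (k : Φ) :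
    ∑ k', (((1 : Matrix Φ Φ ℚ) k k' : ℚ) : ℝ) * z k' = z k := by
  rw [Finset.sum_eq_single k]
  · simp
  · intro k' _ h
    simp [Matrix.one_apply_ne h.symm]
  · simp

lemma abs_one_apply_le {Φ : Type*} [DecidableEq Φ] (k k' : Φ) :
    |(((1 : Matrix Φ Φ ℚ) k k' : ℚ) : ℝ)| ≤ 1 := by
  rw [Matrix.one_apply]
  split_ifs <;> simp

/-- A head that, by a margin `G` in the scores, selects the position `j`. -/
lemma Datatype.Approx.abs_attention_sub_le_of_gap (hD : D.Approx ε) (ν : NormKind) {N : ℕ}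
    (e : Fin d ≃ Fin 4 × Φ) (hκ : 8 ≤ κ) (hd : d ≤ κ) {mask : Φ → ℚ}
    (hmask : ∀ k, |(mask k : ℝ)| ≤ 4) {Q B : Matrix Φ Φ ℚ} (hB : ∀ k k', |(B k k' : ℝ)| ≤ 4)
    {n : ℝ} (hn : 1 ≤ n) (hQ : ∀ k k', |(Q k k' : ℝ)| ≤ n) {R : ℝ} (hR : 1 ≤ R)
    {v : Fin N → Φ → ℝ} (hv : ∀ j k, |v j k| ≤ 1)
    (hsq : ∀ j, ∑ k, (mask k * v j k : ℝ) ^ 2 = R ^ 2)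
    {x : Fin N → Fin (1 * d) → ℝ} (hx : ∀ j c, |x j c - lift e (v j) c| ≤ η)
    {i j : Fin N} (hj : j ≤ i) {q : Φ → ℝ}
    (hq : ∀ k, ∑ k', (Q k k' : ℝ) * maskedFeatures mask R (v i) k' = q k)
    (hq1 : ∀ k, |q k| ≤ n) {G : ℝ}
    (hG : ∀ j' ≤ i, j' ≠ j → 4 * ∑ k, q k * maskedFeatures mask R (v j') k + G
      ≤ 4 * ∑ k, q k * maskedFeatures mask R (v j) k)
    {v' : Φ → ℝ} (hv' : ∀ k, |v' k| ≤ 1)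
    (hout : ∀ k, v i k + ∑ k', (B k k' : ℝ) * maskedFeatures mask R (v j) k' = v' k)
    (hεη : ε ≤ η) (hη : κ ^ 9 * η ≤ 1) (hnη : n * κ ^ 8 * η ≤ 1)
    (hGη : 2 * (n * κ ^ 8 * η) < G) (c : Fin (1 * d)) :
    |(featureAttention e mask Q B).apply D ν x i c - lift e v' c| ≤ κ ^ 9 * η := by
  have hε := hD.pos
  have hη0 : 0 < η := hε.trans_le hεη
  have hκ1 : 1 ≤ κ := by linarith
  have hmono : ∀ a b : ℕ, a ≤ b → κ ^ a * η ≤ κ ^ b * η := fun a b hab =>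
    mul_le_mul_of_nonneg_right (pow_le_pow_right₀ hκ1 hab) hη0.le
  have hεp : ∀ a : ℕ, ε ≤ κ ^ a * η := fun a => hεη.trans (by simpa using hmono 0 a a.zero_le)
  have hsmall : ∀ a ≤ 9, κ ^ a * η ≤ 1 := fun a ha => (hmono a 9 ha).trans hη
  have hmonon : ∀ a b : ℕ, a ≤ b → n * κ ^ a * η ≤ n * κ ^ b * η := fun a b hab => by
    rw [mul_assoc, mul_assoc]
    exact mul_le_mul_of_nonneg_left (hmono a b hab) (by linarith)
  set z : Fin N → Φ → ℝ := fun j => maskedFeatures mask R (v j) with hzdef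
  have hz1 : ∀ j k, |z j k| ≤ 1 := fun j k => abs_maskedFeatures_le hR (hsq j) k
  have hz := fun j => hD.abs_preNorm_lift_sub_le ν e hκ hd hmask (hv j) hR (hsq j) (hx j) hεη
    (hsmall 3 (by norm_num))
  have hkey : ∀ j (r : Fin d), |D.mulVec (fun j => readRow e ((1 : Matrix Φ Φ ℚ) (e j).2))
      (preNorm D ν (fun c => mask (coord e c).2) (x j)) r - z j (e r).2| ≤ κ ^ 5 * η := by
    intro j r
    have h5 : 1 * κ ^ 2 * (κ ^ 3 * η) = κ ^ 5 * η := by ring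
    have := hD.abs_mulVec_readRow_sub_le e hκ hd le_rfl (fun k k' => abs_one_apply_le k k')
      (hz j) (hz1 j) (hεp 3) (by rw [h5]; exact hsmall 5 (by norm_num)) r
    rwa [sum_one_mul, h5] at this
  have hquery : ∀ r : Fin d, |D.mulVec (fun j => readRow e (Q (e j).2))
      (preNorm D ν (fun c => mask (coord e c).2) (x i)) r - q (e r).2| ≤ n * κ ^ 5 * η := by
    intro r
    have h5 : n * κ ^ 2 * (κ ^ 3 * η) = n * κ ^ 5 * η := by ring
    have := hD.abs_mulVec_readRow_sub_le e hκ hd hn hQ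
      (hz i) (hz1 i) (hεp 3) (by rw [h5]; exact (hmonon 5 8 (by norm_num)).trans hnη) r
    rwa [hq, h5] at this
  -- Queries and keys read only the first copy but are written, without signs, to all four; hence
  -- the factor `4` in the ideal score.
  have hscore : ∀ j, |D.dot (D.mulVec (fun j => readRow e (Q (e j).2))
      (preNorm D ν (fun c => mask (coord e c).2) (x i)))
      (D.mulVec (fun j => readRow e ((1 : Matrix Φ Φ ℚ) (e j).2))
      (preNorm D ν (fun c => mask (coord e c).2) (x j))) - 4 * ∑ k, q k * z j k|
      ≤ n * κ ^ 8 * η := by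
    intro j
    set Y := D.mulVec (fun j => readRow e (Q (e j).2))
      (preNorm D ν (fun c => mask (coord e c).2) (x i))
    set Z := D.mulVec (fun j => readRow e ((1 : Matrix Φ Φ ℚ) (e j).2))
      (preNorm D ν (fun c => mask (coord e c).2) (x j))
    have hY : ∀ r, |Y r| ≤ n + 1 := fun r => by
      have h1 := hquery r
      have h2 := hq1 (e r).2
      have h3 := (hmonon 5 8 (by norm_num)).trans hnη
      rw [abs_le] at *
      constructor <;> linarith
    have hZ : ∀ r, |Z r| ≤ 2 := fun r => by
      have h1 := hkey j r
      have h2 := hz1 j (e r).2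
      have h3 := hsmall 5 (by norm_num)
      rw [abs_le] at *
      constructor <;> linarith
    have hd0 : (0 : ℝ) ≤ d := Nat.cast_nonneg d
    have h1 := hD.abs_dot_sub_le Y Z (P := (n + 1) * 2) (by linarith)
      (fun r => by
        rw [abs_mul]
        exact mul_le_mul (hY r) (hZ r) (abs_nonneg _) (by linarith))
      (by
        have e1 : (n + 1) * 2 + 2 ≤ n * κ := by nlinarith
        have e2 : (d : ℝ) * ((n + 1) * 2 + 2) ≤ κ * (n * κ) :=
          mul_le_mul hd e1 (by linarith) (by linarith)
        calc _ ≤ κ * (n * κ) * η := mul_le_mul e2 hεη hε.le (by positivity)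
          _ = n * κ ^ 2 * η := by ring
          _ ≤ _ := hmonon 2 8 (by norm_num)
          _ ≤ _ := hnη)
    have h2 : ∑ r : Fin d, q (e r).2 * z j (e r).2 = 4 * ∑ k, q k * z j k := by
      rw [Equiv.sum_comp e (fun p => q p.2 * z j p.2), Fintype.sum_prod_type]
      simp
    have h3 : |∑ r, Y r * Z r - 4 * ∑ k, q k * z j k| ≤ d * (3 * (n * κ ^ 5 * η)) := by
      rw [← h2, ← Finset.sum_sub_distrib]
      refine (Finset.abs_sum_le_sum_abs _ _).trans ?_
      refine (Finset.sum_le_sum (g := fun _ => 3 * (n * κ ^ 5 * η)) fun r _ => ?_).trans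
        (by simp)
      have : Y r * Z r - q (e r).2 * z j (e r).2
          = (Y r - q (e r).2) * Z r + q (e r).2 * (Z r - z j (e r).2) := by ring
      rw [this]
      refine (abs_add_le _ _).trans ?_
      rw [abs_mul, abs_mul]
      have e1 := mul_le_mul (hquery r) (hZ r) (abs_nonneg _) (by positivity)
      have e2 := mul_le_mul (hq1 (e r).2) (hkey j r) (abs_nonneg _) (by linarith)
      linarith
    refine (abs_sub_le _ _ _).trans ((add_le_add h1 h3).trans ?_)
    have e0 : η ≤ n * κ ^ 5 * η := by
      have : 1 ≤ n * κ ^ 5 := one_le_mul_of_one_le_of_one_le hn (one_le_pow₀ hκ1)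
      nlinarith
    have e1 : 2 * (d : ℝ) * ε + d * (3 * (n * κ ^ 5 * η)) ≤ d * (5 * (n * κ ^ 5 * η)) := by
      have := mul_le_mul_of_nonneg_left (hεη.trans e0) hd0
      linarith
    refine e1.trans ?_
    have e2 : (d : ℝ) * 5 ≤ κ ^ 3 := by
      have : 64 ≤ κ ^ 2 := by nlinarith
      nlinarith
    calc (d : ℝ) * (5 * (n * κ ^ 5 * η)) = d * 5 * (n * κ ^ 5 * η) := by ring
      _ ≤ κ ^ 3 * (n * κ ^ 5 * η) := mul_le_mul_of_nonneg_right e2 (by positivity)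
      _ = _ := by ring
  have h64 : 64 ≤ κ ^ 2 := by nlinarith
  have h6 : κ ^ 5 * η + 2 * ε ≤ κ ^ 6 * η := by
    have h7 : κ ^ 6 * η = κ * (κ ^ 5 * η) := by ring
    have := hεp 5
    nlinarith
  -- Inexact scores still select `j`, as the gap exceeds twice their error. The selected value has
  -- error free of `n`, so the sublayer costs only `κ ^ 9`.
  have := hD.abs_attention_sub_le ν e hκ hd (mask := mask) (Q := Q) hB i (v := v i) (v' := v')
    (a := z j) (θ := κ ^ 6 * η) (x := x)
    (fun c => (hx i c).trans (by simpa using hmono 0 6 (by norm_num)))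
    (fun r => (hD.abs_headOutput_sub_le_of_unique hj (fun j' hj' hne => by
        have e1 := hscore j'
        have e2 := hscore j
        have e3 := hG j' hj' hne
        rw [abs_le] at e1 e2
        linarith) (hkey j r) (hz1 j _) (hsmall 5 (by norm_num))
        (by
          have := hsmall 2 (by norm_num)
          nlinarith)).trans h6)
    (hz1 j) hv' hout (hεp 6) (by rw [← mul_assoc, ← pow_add]; exact hη) c
  rwa [← mul_assoc, ← pow_add] at this

/-- A head with vanishing queries averages over all positions. -/
lemma Datatype.Approx.abs_attention_sub_le_of_uniform (hD : D.Approx ε) (ν : NormKind) {N : ℕ}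
    (e : Fin d ≃ Fin 4 × Φ) (hκ : 8 ≤ κ) (hd : d ≤ κ) {mask : Φ → ℚ}
    (hmask : ∀ k, |(mask k : ℝ)| ≤ 4) {B : Matrix Φ Φ ℚ} (hB : ∀ k k', |(B k k' : ℝ)| ≤ 4)
    {n : ℝ} (hn : 1 ≤ n) (hN : N ≤ 2 * n) {R : Fin N → ℝ} (hR : ∀ j, 1 ≤ R j)
    {v : Fin N → Φ → ℝ} (hv : ∀ j k, |v j k| ≤ 1)
    (hsq : ∀ j, ∑ k, (mask k * v j k : ℝ) ^ 2 = R j ^ 2)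
    {x : Fin N → Fin (1 * d) → ℝ} (hx : ∀ j c, |x j c - lift e (v j) c| ≤ η)
    (i : Fin N) {v' : Φ → ℝ} (hv' : ∀ k, |v' k| ≤ 1)
    (hout : ∀ k, v i k + ∑ k', (B k k' : ℝ) *
      ((∑ j ∈ Finset.Iic i, maskedFeatures mask (R j) (v j) k') / (i + 1)) = v' k)
    (hεη : ε ≤ η) (hη : n * κ ^ 9 * η ≤ 1) (c : Fin (1 * d)) :
    |(featureAttention e mask 0 B).apply D ν x i c - lift e v' c| ≤ n * κ ^ 9 * η := by
  have hε := hD.pos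
  have hη0 : 0 < η := hε.trans_le hεη
  have hκ1 : 1 ≤ κ := by linarith
  have hmono : ∀ a b : ℕ, a ≤ b → κ ^ a * η ≤ κ ^ b * η := fun a b hab =>
    mul_le_mul_of_nonneg_right (pow_le_pow_right₀ hκ1 hab) hη0.le
  have hεp : ∀ a : ℕ, ε ≤ κ ^ a * η := fun a => hεη.trans (by simpa using hmono 0 a a.zero_le)
  have hle : ∀ a : ℕ, κ ^ a * η ≤ n * κ ^ a * η := fun a => by
    rw [mul_assoc]
    exact le_mul_of_one_le_left (by positivity) hn
  have hsmall : ∀ a ≤ 9, κ ^ a * η ≤ 1 := fun a ha => (hmono a 9 ha).trans ((hle 9).trans hη)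
  have hz1 : ∀ j k, |maskedFeatures mask (R j) (v j) k| ≤ 1 := fun j k =>
    abs_maskedFeatures_le (hR j) (hsq j) k
  have hz := fun j => hD.abs_preNorm_lift_sub_le ν e hκ hd hmask (hv j) (hR j) (hsq j) (hx j) hεη
    (hsmall 3 (by norm_num))
  have hkey : ∀ j (r : Fin d), |D.mulVec (fun j => readRow e ((1 : Matrix Φ Φ ℚ) (e j).2))
      (preNorm D ν (fun c => mask (coord e c).2) (x j)) r
      - maskedFeatures mask (R j) (v j) (e r).2| ≤ κ ^ 5 * η := by
    intro j r
    have h5 : 1 * κ ^ 2 * (κ ^ 3 * η) = κ ^ 5 * η := by ring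
    have := hD.abs_mulVec_readRow_sub_le e hκ hd le_rfl (fun k k' => abs_one_apply_le k k')
      (hz j) (hz1 j) (hεp 3) (by rw [h5]; exact hsmall 5 (by norm_num)) r
    rwa [sum_one_mul, h5] at this
  have h64 : 64 ≤ κ ^ 2 := by nlinarith
  have hε9 : n * κ ^ 2 * ε ≤ n * κ ^ 9 * η := by
    rw [mul_assoc, mul_assoc]
    refine mul_le_mul_of_nonneg_left ?_ (by linarith)
    exact (mul_le_mul_of_nonneg_left hεη (by positivity)).trans (hmono 2 9 (by norm_num))
  have h6 : κ ^ 5 * η + (4 * N + 1) * ε ≤ n * κ ^ 6 * η := by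
    have h7 : n * κ ^ 6 * η = n * (κ * (κ ^ 5 * η)) := by ring
    have h8 := hεη.trans (by simpa using hmono 0 5 (by norm_num))
    have h9 : (4 * (N : ℝ) + 1) * ε ≤ (9 * n) * ε := by nlinarith
    have h10 : n * ε ≤ n * (κ * (κ ^ 2 * η)) := by
      refine mul_le_mul_of_nonneg_left ?_ (by linarith)
      calc ε ≤ κ ^ 3 * η := hεp 3
        _ = _ := by ring
    have h11 : κ ^ 5 * η = κ ^ 2 * (κ * (κ ^ 2 * η)) := by ring
    set w := κ * (κ ^ 2 * η)
    have hw : 0 ≤ w := by positivity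
    have h12 : 9 * w ≤ κ ^ 5 * η := by rw [h11]; nlinarith
    have h13 : n * (9 * w) ≤ n * (κ ^ 5 * η) := mul_le_mul_of_nonneg_left h12 (by linarith)
    have h14 : κ ^ 5 * η ≤ n * (κ ^ 5 * η) := le_mul_of_one_le_left (by positivity) hn
    have h15 : n * (κ ^ 5 * η) * 8 ≤ n * (κ ^ 5 * η) * κ :=
      mul_le_mul_of_nonneg_left hκ (by positivity)
    have h16 : 0 ≤ n * (κ ^ 5 * η) := by positivity
    rw [h7]
    nlinarith
  -- Hard attention is discontinuous, so ties must be exact. Zero queries give scores exactly `0`,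
  -- because rounding fixes `0`.
  have hzero : ∀ j j', D.dot (D.mulVec (fun j => readRow e ((0 : Matrix Φ Φ ℚ) (e j).2))
      (preNorm D ν (fun c => mask (coord e c).2) (x i)))
      (D.mulVec (fun j => readRow e ((1 : Matrix Φ Φ ℚ) (e j).2))
      (preNorm D ν (fun c => mask (coord e c).2) (x j)))
      = D.dot (D.mulVec (fun j => readRow e ((0 : Matrix Φ Φ ℚ) (e j).2))
      (preNorm D ν (fun c => mask (coord e c).2) (x i)))
      (D.mulVec (fun j => readRow e ((1 : Matrix Φ Φ ℚ) (e j).2))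
      (preNorm D ν (fun c => mask (coord e c).2) (x j'))) := by
    have h0 : ∀ y r, D.mulVec (fun j => readRow e ((0 : Matrix Φ Φ ℚ) (e j).2)) y r = 0 :=
      fun y r => D.mulVec_zero hD.round_zero _ _ _ fun c => by simp [readRow]
    intro j j'
    exact (D.dot_zero_left hD.round_zero _ _ fun r => mul_eq_zero_of_left (h0 _ r) _).trans
      (D.dot_zero_left hD.round_zero _ _ fun r => mul_eq_zero_of_left (h0 _ r) _).symm
  have hi1 : (0 : ℝ) < (i : ℝ) + 1 := by positivity
  have := hD.abs_attention_sub_le ν e hκ hd (mask := mask) (Q := 0) hB i (v := v i) (v' := v')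
    (a := fun k => (∑ j ∈ Finset.Iic i, maskedFeatures mask (R j) (v j) k) / (i + 1))
    (θ := n * κ ^ 6 * η) (x := x)
    (fun c => (hx i c).trans ((by simpa using hmono 0 6 (by norm_num) : η ≤ _).trans (hle 6)))
    (fun r => (hD.abs_headOutput_sub_le_of_const (hzero) (fun j => hkey j r) (fun j => hz1 j _)
        (hsmall 5 (by norm_num))
        (by
          have : 4 * ((N : ℝ) + 1) ≤ n * κ ^ 2 := by nlinarith
          have := mul_le_mul_of_nonneg_right this hε.le
          linarith)).trans h6)
    (fun k => by
      rw [abs_div, abs_of_pos hi1, div_le_one hi1]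
      refine (Finset.abs_sum_le_sum_abs _ _).trans ?_
      refine (Finset.sum_le_sum fun j _ => hz1 j k).trans ?_
      simp) hv' hout ((hεp 6).trans (hle 6))
    (by
      calc κ ^ 3 * (n * κ ^ 6 * η) = n * κ ^ 9 * η := by ring
        _ ≤ 1 := hη) c
  calc _ ≤ _ := this
    _ = _ := by ring

end Heads

/-! ### Positions as points of the unit circle -/

/-- The first coordinate of the direction of `(a, 1)`. -/
def posCos (a : ℝ) : ℝ := a / √(a ^ 2 + 1)

/-- The second coordinate of the direction of `(a, 1)`. -/
def posSin (a : ℝ) : ℝ := 1 / √(a ^ 2 + 1)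

lemma posCos_sq_add_posSin_sq (a : ℝ) : posCos a ^ 2 + posSin a ^ 2 = 1 := by
  have h : 0 < a ^ 2 + 1 := by positivity
  rw [posCos, posSin, div_pow, div_pow, Real.sq_sqrt h.le]
  field_simp

lemma posSin_nonneg (a : ℝ) : 0 ≤ posSin a := by unfold posSin; positivity

lemma abs_posCos_le (a : ℝ) : |posCos a| ≤ 1 := by
  have := posCos_sq_add_posSin_sq a
  rw [abs_le_one_iff_mul_self_le_one]
  nlinarith [sq_nonneg (posSin a)]

lemma abs_posSin_le (a : ℝ) : |posSin a| ≤ 1 := by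
  have := posCos_sq_add_posSin_sq a
  rw [abs_le_one_iff_mul_self_le_one]
  nlinarith [sq_nonneg (posCos a)]

lemma sqrt_sq_add_one_le {a : ℝ} (ha : 0 ≤ a) : √(a ^ 2 + 1) ≤ a + 1 := by
  rw [Real.sqrt_le_left (by linarith)]
  nlinarith

/-- Quantitative Cauchy-Schwarz for `(A, 1)` and `(b, 1)`: the squared product of the norms exceeds
the squared inner product by `(A - b) ^ 2 ≥ 1`. -/
lemma mul_posCos_add_posSin_add_le_of_eq {A b m : ℝ} (hA : 0 ≤ A) (hb : 0 ≤ b) (hAm : A + 1 ≤ m)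
    (hbm : b + 1 ≤ m) (hAb : 1 ≤ (A - b) ^ 2) :
    A * posCos b + posSin b + 1 / (2 * m ^ 3) ≤ A * posCos A + posSin A := by
  have hP : √(A ^ 2 + 1) ^ 2 = A ^ 2 + 1 := Real.sq_sqrt (by positivity)
  have hQ : √(b ^ 2 + 1) ^ 2 = b ^ 2 + 1 := Real.sq_sqrt (by positivity)
  have hPm := (sqrt_sq_add_one_le hA).trans hAm
  have hQm := (sqrt_sq_add_one_le hb).trans hbm
  have hP0 : 0 < √(A ^ 2 + 1) := by positivity
  have hQ0 : 0 < √(b ^ 2 + 1) := by positivity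
  have e1 : A * posCos A + posSin A = √(A ^ 2 + 1) := by
    unfold posCos posSin
    field_simp
    linarith
  have e2 : A * posCos b + posSin b = (A * b + 1) / √(b ^ 2 + 1) := by
    unfold posCos posSin
    field_simp
  rw [e1, e2]
  set P := √(A ^ 2 + 1)
  set S := √(b ^ 2 + 1)
  have hprod : (P * S) ^ 2 = (A * b + 1) ^ 2 + (A - b) ^ 2 := by
    rw [mul_pow, hP, hQ]; ring
  have hAb0 : 0 ≤ A * b + 1 := by positivity
  have hPS : 0 < P * S := by positivity
  have hle : A * b + 1 ≤ P * S := by nlinarith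
  have h1 : 1 / (2 * (P * S)) ≤ P * S - (A * b + 1) := by
    rw [div_le_iff₀ (by positivity)]
    nlinarith
  have hm0 : 0 ≤ m := hP0.le.trans hPm
  have h2 : 1 / (2 * m ^ 3) ≤ 1 / (2 * (P * S)) / S := by
    rw [div_div]
    refine one_div_le_one_div_of_le (by positivity) ?_
    have : P * S * S ≤ m * m * m := by gcongr
    linarith
  have h3 : 1 / (2 * (P * S)) / S ≤ (P * S - (A * b + 1)) / S := by gcongr
  have h4 : (P * S - (A * b + 1)) / S = P - (A * b + 1) / S := by field_simp
  linarith

/-- The case of a shift beyond the start: for `A ≤ 0` the first position is best, since `posCos`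
increases and `posSin` decreases. -/
lemma mul_posCos_add_posSin_add_le_of_nonpos {A b m : ℝ} (hA : A ≤ 0) (hb : 2 ≤ b) (hm : 2 ≤ m) :
    A * posCos b + posSin b + 1 / (2 * m ^ 3) ≤ A * posCos 1 + posSin 1 := by
  have h1 : √((1 : ℝ) ^ 2 + 1) ≤ 3 / 2 := by
    rw [Real.sqrt_le_left (by norm_num)]
    norm_num
  have h2 : 2 ≤ √(b ^ 2 + 1) := Real.le_sqrt_of_sq_le (by nlinarith)
  have hs1 : 2 / 3 ≤ posSin 1 := by
    unfold posSin
    rw [le_div_iff₀ (by positivity)]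
    linarith
  have hsb : posSin b ≤ 1 / 2 := one_div_le_one_div_of_le (by norm_num) h2
  have hc : posCos 1 ≤ posCos b := by
    have c1 := posCos_sq_add_posSin_sq 1
    have cb := posCos_sq_add_posSin_sq b
    have p1 := posSin_nonneg b
    have p2 : 0 ≤ posCos b := by unfold posCos; positivity
    nlinarith
  have hm3 : 1 / (2 * m ^ 3) ≤ 1 / 16 := by
    refine one_div_le_one_div_of_le (by norm_num) ?_
    have : (2 : ℝ) ^ 3 ≤ m ^ 3 := by gcongr
    linarith
  nlinarith

/-- Among the directions of the positions, the one of `i - s` is closest to the direction obtained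
from that of position `i` by a shift of `s`. -/
lemma position_gap {n i s j : ℕ} (hn : 2 ≤ n) (hi : i ≤ n) (hji : j ≤ i) (hj : j ≠ i - s) :
    (posCos (i + 1) - s * posSin (i + 1)) * posCos (j + 1) + posSin (i + 1) * posSin (j + 1)
        + 1 / (32 * (n : ℝ) ^ 4)
      ≤ (posCos (i + 1) - s * posSin (i + 1)) * posCos ((i - s : ℕ) + 1)
        + posSin (i + 1) * posSin ((i - s : ℕ) + 1) := by
  have hn' : (2 : ℝ) ≤ n := by exact_mod_cast hn
  have hi' : (i : ℝ) ≤ n := by exact_mod_cast hi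
  have hji' : (j : ℝ) ≤ i := by exact_mod_cast hji
  have hi0 : (0 : ℝ) ≤ i := Nat.cast_nonneg i
  have hj0 : (0 : ℝ) ≤ j := Nat.cast_nonneg j
  have hcos : posCos ((i : ℝ) + 1) = posSin (i + 1) * (i + 1) := by
    unfold posCos posSin
    ring
  -- The query is `posSin (i + 1)` times `(i + 1 - s, 1)`. The bound `m = 2 * n` works since `i + 2
  -- ≤ 2 * n`; the scalar is at least `1 / (2 * n)`, whence the fourth power.
  have key : ((i : ℝ) + 1 - s) * posCos (j + 1) + posSin (j + 1) + 1 / (2 * (2 * n : ℝ) ^ 3)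
      ≤ ((i : ℝ) + 1 - s) * posCos ((i - s : ℕ) + 1) + posSin ((i - s : ℕ) + 1) := by
    rcases le_total s i with hs | hs
    · have hs' : (s : ℝ) ≤ i := by exact_mod_cast hs
      have e : (((i - s : ℕ) : ℝ) + 1) = (i : ℝ) + 1 - s := by
        rw [Nat.cast_sub hs]; ring
      rw [e]
      refine mul_posCos_add_posSin_add_le_of_eq (by linarith) (by linarith)
        (by linarith [(Nat.cast_nonneg s : (0 : ℝ) ≤ s)]) (by linarith) ?_
      have : ((i : ℤ) - s - j) ≠ 0 := by omega
      have h1 : (1 : ℤ) ≤ ((i : ℤ) - s - j) ^ 2 := by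
        have := sq_pos_of_ne_zero this
        omega
      have h2 : (1 : ℝ) ≤ ((i : ℝ) - s - j) ^ 2 := by exact_mod_cast h1
      calc _ ≤ _ := h2
        _ = _ := by ring
    · rcases hs.eq_or_lt with rfl | hs1
      · have hj1 : (1 : ℝ) ≤ j := by
          have : 1 ≤ j := by omega
          exact_mod_cast this
        simp only [Nat.sub_self, Nat.cast_zero, zero_add, add_sub_cancel_left]
        refine mul_posCos_add_posSin_add_le_of_eq (by linarith) (by linarith)
          (by linarith) (by linarith) ?_
        nlinarith
      · have hj1 : (1 : ℝ) ≤ j := by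
          have : 1 ≤ j := by omega
          exact_mod_cast this
        have hs2 : (i : ℝ) + 1 ≤ s := by exact_mod_cast hs1
        rw [Nat.sub_eq_zero_of_le hs, Nat.cast_zero, zero_add]
        exact mul_posCos_add_posSin_add_le_of_nonpos (by linarith) (by linarith) (by linarith)
  have hS : 1 / (2 * n : ℝ) ≤ posSin (i + 1) := by
    unfold posSin
    refine one_div_le_one_div_of_le (by positivity) ?_
    exact (sqrt_sq_add_one_le (by linarith)).trans (by linarith)
  have hS0 := posSin_nonneg ((i : ℝ) + 1)
  have hmul := mul_le_mul_of_nonneg_left key hS0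
  have hg : 1 / (32 * (n : ℝ) ^ 4) ≤ posSin (i + 1) * (1 / (2 * (2 * n : ℝ) ^ 3)) := by
    calc 1 / (32 * (n : ℝ) ^ 4) = 1 / (2 * n : ℝ) * (1 / (2 * (2 * n : ℝ) ^ 3)) := by
          field_simp; norm_num
      _ ≤ _ := mul_le_mul_of_nonneg_right hS (by positivity)
  rw [hcos]
  nlinarith

/-! ### Prefix products by recursive doubling -/

/-- The features: the one-hot encodings of the product over a window and of a fetched product, and
the scalars `1`, the indicator of the first position, the inverse of the position, and the
direction of the position. -/
abbrev Feature (M : Type*) := (M ⊕ M) ⊕ Fin 5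

section Doubling

variable {M : Type*} [DecidableEq M]

/-- The feature vector with the given entries. -/
def features (f : M) (g : Option M) (b r c s : ℝ) : Feature M → ℝ
  | .inl (.inl m) => if m = f then 1 else 0
  | .inl (.inr m) => if g = some m then 1 else 0
  | .inr k => ![1, b, r, c, s] k

lemma abs_features_le (f : M) (g : Option M) {b r c s : ℝ} (hb : |b| ≤ 1) (hr : |r| ≤ 1)
    (hc : |c| ≤ 1) (hs : |s| ≤ 1) (k : Feature M) : |features f g b r c s k| ≤ 1 := by
  rcases k with (m | m) | k
  · simp only [features]; split_ifs <;> simp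
  · simp only [features]; split_ifs <;> simp
  · fin_cases k <;> simp [features, hb, hr, hc, hs]

/-- The mask with the given weights on the two one-hot encodings and the scalars. -/
def blockMask (x y : ℚ) (s : Fin 5 → ℚ) : Feature M → ℚ :=
  Sum.elim (Sum.elim (fun _ => x) fun _ => y) s

omit [DecidableEq M] in
lemma abs_blockMask_le {x y : ℚ} {s : Fin 5 → ℚ} (hx : |x| ≤ 4) (hy : |y| ≤ 4)
    (hs : ∀ k, |s k| ≤ 4) (k : Feature M) : |(blockMask x y s k : ℝ)| ≤ 4 := by
  rcases k with (m | m) | k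
  · exact_mod_cast hx
  · exact_mod_cast hy
  · exact_mod_cast hs k

/-- The feature vector of position `i` before the first layer. -/
def initFeatures (X : ℕ → M) (i : ℕ) : Feature M → ℝ :=
  features (X i) none (if i = 0 then 1 else 0) 0 0 0

/-- The feature vector of position `i` after its inverse is computed. -/
def inverseFeatures (X : ℕ → M) (i : ℕ) : Feature M → ℝ :=
  features (X i) none (if i = 0 then 1 else 0) (1 / (i + 1)) 0 0

/-- The feature vector of position `i` between the layers that double the window, when it holds
the product `X i` and `g` is fetched. -/
def windowFeatures (X : ℕ → M) (g : Option M) (i : ℕ) : Feature M → ℝ :=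
  features (X i) g (if i = 0 then 1 else 0) (1 / (i + 1)) (posCos (i + 1)) (posSin (i + 1))

lemma abs_indicator_le (i : ℕ) : |(if i = 0 then 1 else 0 : ℝ)| ≤ 1 := by
  split_ifs <;> simp

lemma abs_inverse_le (i : ℕ) : |(1 / ((i : ℝ) + 1))| ≤ 1 := by
  rw [abs_of_nonneg (by positivity), div_le_one (by positivity)]
  linarith [(Nat.cast_nonneg i : (0 : ℝ) ≤ i)]

lemma abs_initFeatures_le (X : ℕ → M) (i : ℕ) (k) : |initFeatures X i k| ≤ 1 :=
  abs_features_le _ _ (abs_indicator_le i) (by simp) (by simp) (by simp) k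

lemma abs_inverseFeatures_le (X : ℕ → M) (i : ℕ) (k) : |inverseFeatures X i k| ≤ 1 :=
  abs_features_le _ _ (abs_indicator_le i) (abs_inverse_le i) (by simp) (by simp) k

lemma abs_windowFeatures_le (X : ℕ → M) (g : Option M) (i : ℕ) (k) :
    |windowFeatures X g i k| ≤ 1 :=
  abs_features_le _ _ (abs_indicator_le i) (abs_inverse_le i) (abs_posCos_le _) (abs_posSin_le _) k

/-- Writes the inverse of the position. -/
def inverseOut : Matrix (Feature M) (Feature M) ℚ := fun k k' =>
  if k = .inr 2 ∧ k' = .inr 1 then 5 / 2 else 0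

/-- Reads the constant and the inverse of the position. -/
def directionIn : Matrix ((M × M) ⊕ Fin 2) (Feature M) ℚ := fun b k =>
  if (b = .inr 0 ∧ k = .inr 0) ∨ (b = .inr 1 ∧ k = .inr 2) then 1 else 0

/-- Writes the direction of the position. -/
def directionOut : Matrix (Feature M) ((M × M) ⊕ Fin 2) ℚ := fun k b =>
  if (b = .inr 0 ∧ k = .inr 3) ∨ (b = .inr 1 ∧ k = .inr 4) then 2 else 0

/-- The query for the position at distance `s`. -/
def shiftQuery (s : ℕ) : Matrix (Feature M) (Feature M) ℚ
  | .inr k, .inr k' =>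
    if k = 3 ∧ k' = 3 ∨ k = 4 ∧ k' = 4 then 1 else if k = 3 ∧ k' = 4 then -s else 0
  | _, _ => 0

/-- Writes the fetched product. -/
def fetchOut : Matrix (Feature M) (Feature M) ℚ
  | .inl (.inr m), .inl (.inl m') => if m = m' then 5 / 2 else 0
  | _, _ => 0

/-- Detects pairs of a product and a fetched product. -/
def productIn : Matrix ((M × M) ⊕ Fin 2) (Feature M) ℚ
  | .inl p, .inl (.inl m) => if m = p.1 then 1 else 0
  | .inl p, .inl (.inr m) => if m = p.2 then 1 else 0
  | .inl _, .inr k => if k = 0 then -2 else 0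
  | .inr _, _ => 0

/-- Replaces a product by its product with the fetched one, which is cleared. -/
def productOut [Mul M] : Matrix (Feature M) ((M × M) ⊕ Fin 2) ℚ
  | .inl (.inl m), .inl p => (if m = p.1 * p.2 then 3 else 0) - if m = p.1 then 3 else 0
  | .inl (.inr m), .inl p => if m = p.2 then -3 else 0
  | _, _ => 0

variable [Fintype M] {d w n : ℕ} {D : Datatype} {ε κ η : ℝ}

/-- The layer that computes the directions of the positions. -/
def positionLayer (e : Fin d ≃ Fin 4 × Feature M) (eH : Fin w ≃ (M × M) ⊕ Fin 2) : Layer 1 d w where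
  attention := featureAttention e (blockMask 0 0 ![3, 4, 0, 0, 0]) 0 inverseOut
  feedforward := featureFeedforward e eH (blockMask 0 0 ![1, 0, 1, 0, 0]) directionIn directionOut

/-- The layer that multiplies the product at each position with the one at distance `s`. -/
def doublingLayer [Mul M] (e : Fin d ≃ Fin 4 × Feature M) (eH : Fin w ≃ (M × M) ⊕ Fin 2) (s : ℕ) :
    Layer 1 d w where
  attention := featureAttention e (blockMask 4 0 ![0, 0, 0, 3, 3]) (shiftQuery s) fetchOut
  feedforward := featureFeedforward e eH (blockMask 2 2 ![1, 0, 0, 0, 0]) productIn productOut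

lemma Datatype.Approx.abs_positionLayer_sub_le (hD : D.Approx ε) (ν : NormKind)
    (e : Fin d ≃ Fin 4 × Feature M) (eH : Fin w ≃ (M × M) ⊕ Fin 2) (hκ : 8 ≤ κ) (hd : d ≤ κ)
    (hw : w ≤ κ) (hn : 2 ≤ n) (X : ℕ → M) {x : Fin (n + 1) → Fin (1 * d) → ℝ}
    (hx : ∀ i c, |x i c - lift e (initFeatures X i) c| ≤ η) (hεη : ε ≤ η)
    (hη : n * κ ^ 18 * η ≤ 1) (i : Fin (n + 1)) (c : Fin (1 * d)) :
    |(positionLayer e eH).apply D ν x i c - lift e (windowFeatures X none i) c|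
      ≤ n * κ ^ 18 * η := by
  have hε := hD.pos
  have hη0 : 0 < η := hε.trans_le hεη
  have hn' : (2 : ℝ) ≤ n := by exact_mod_cast hn
  have h9 : n * κ ^ 9 * η ≤ n * κ ^ 18 * η := by
    have : κ ^ 9 ≤ κ ^ 18 := pow_le_pow_right₀ (by linarith) (by norm_num)
    gcongr
  have hatt : ∀ i c, |(featureAttention e (blockMask 0 0 ![3, 4, 0, 0, 0]) 0 inverseOut).apply
      D ν x i c - lift e (inverseFeatures X i) c| ≤ n * κ ^ 9 * η := by
    intro i c
    -- Mask weights `3` and `4` give norm `5` at the first position and `3` elsewhere. The indicator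
    -- is read as `4 / (2 * 5) = 2 / 5`, which the weight `5 / 2` undoes.
    refine hD.abs_attention_sub_le_of_uniform ν e hκ hd
      (abs_blockMask_le (by norm_num) (by norm_num) (fun k => ?_)) (fun k k' => ?_)
      (n := n) (by linarith) (by push_cast; linarith) (R := fun j => if j = 0 then 5 else 3)
      (fun j => ?_) (v := fun j => initFeatures X j) (fun j k => abs_initFeatures_le X j k)
      (fun j => ?_) hx i (abs_inverseFeatures_le X i) (fun k => ?_) hεη (h9.trans hη) c
    · fin_cases k <;> norm_num
    · unfold inverseOut
      split_ifs <;> norm_num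
    · split_ifs <;> norm_num
    · rw [Fintype.sum_sum_type, Fintype.sum_sum_type, Fin.sum_univ_five]
      have : ((j : ℕ) = 0) ↔ j = 0 := by rw [Fin.ext_iff]; rfl
      simp only [blockMask, initFeatures, features, this]
      split_ifs <;> simp <;> norm_num
    · have hsum : ∑ j ∈ Finset.Iic i, maskedFeatures (blockMask 0 0 ![3, 4, 0, 0, 0])
          (if j = 0 then 5 else 3) (initFeatures X j) (.inr 1) = 2 / 5 := by
        rw [Finset.sum_eq_single_of_mem 0 (Finset.mem_Iic.2 (Fin.zero_le _))]
        · simp [maskedFeatures, blockMask, initFeatures, features]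
          norm_num
        · intro j _ hj
          simp [maskedFeatures, blockMask, initFeatures, features, hj]
      rw [Finset.sum_eq_single (.inr 1) (fun k' _ hk' => by simp [inverseOut, hk']) (by simp),
        hsum]
      rcases k with (m | m) | k
      · simp [initFeatures, inverseFeatures, inverseOut, features]
      · simp [initFeatures, inverseFeatures, inverseOut, features]
      · fin_cases k <;> simp [initFeatures, inverseFeatures, inverseOut, features]
        field_simp
  have ha : (0 : ℝ) < (i : ℝ) + 1 := by positivity
  have hr : 0 < √(((i : ℝ) + 1) ^ 2 + 1) := by positivity
  have hr2 : √(((i : ℝ) + 1) ^ 2 + 1) ^ 2 = ((i : ℝ) + 1) ^ 2 + 1 := Real.sq_sqrt (by positivity)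
  -- Normalizing `(1, 1 / (i + 1))` yields half of `(posSin, posCos)` at `i + 1`; both entries are
  -- nonnegative and pass through ReLU.
  have hff := hD.abs_feedforward_sub_le ν e eH hκ hd hw
    (mask := blockMask 0 0 ![1, 0, 1, 0, 0])
    (abs_blockMask_le (by norm_num) (by norm_num) (fun k => by fin_cases k <;> norm_num))
    (A := directionIn) (fun b k => by unfold directionIn; split_ifs <;> norm_num)
    (U := directionOut) (fun b k => by unfold directionOut; split_ifs <;> norm_num)
    (abs_inverseFeatures_le X i) (R := √(((i : ℝ) + 1) ^ 2 + 1) / (i + 1))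
    (by
      rw [le_div_iff₀ ha, one_mul]
      exact Real.le_sqrt_of_sq_le (by linarith))
    (by
      rw [Fintype.sum_sum_type, Fintype.sum_sum_type, Fin.sum_univ_five, div_pow, hr2]
      simp [blockMask, inverseFeatures, features]
      field_simp)
    (g := Sum.elim 0 ![posCos (i + 1) / 2, posSin (i + 1) / 2])
    (fun b => by
      have hc : 0 ≤ posCos ((i : ℝ) + 1) := by unfold posCos; positivity
      have hs := posSin_nonneg ((i : ℝ) + 1)
      rw [Fintype.sum_sum_type, Fintype.sum_sum_type, Fin.sum_univ_five]
      rcases b with p | b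
      · simp [directionIn]
      · fin_cases b
        · simp [directionIn, maskedFeatures, blockMask, inverseFeatures, features]
          rw [max_eq_left (by positivity)]
          unfold posCos
          field_simp
        · simp [directionIn, maskedFeatures, blockMask, inverseFeatures, features]
          rw [max_eq_left (by positivity)]
          unfold posSin
          field_simp)
    (fun b => by
      have hc := abs_le.1 (abs_posCos_le ((i : ℝ) + 1))
      have hs := abs_le.1 (abs_posSin_le ((i : ℝ) + 1))
      rcases b with p | b
      · simp
      · fin_cases b <;> simp <;> linarith)
    (abs_windowFeatures_le X none i)
    (fun k => by
      rw [Fintype.sum_sum_type, Fin.sum_univ_two]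
      rcases k with (m | m) | k
      · simp [directionOut, inverseFeatures, windowFeatures, features]
      · simp [directionOut, inverseFeatures, windowFeatures, features]
      · fin_cases k <;> simp [directionOut, inverseFeatures, windowFeatures, features] <;> ring)
    i (hatt i)
    (hεη.trans (le_mul_of_one_le_left hη0.le
      (one_le_mul_of_one_le_of_one_le (by linarith) (one_le_pow₀ (by linarith)))))
    (by
      calc _ = n * κ ^ 18 * η := by ring
        _ ≤ 1 := hη) c
  refine hff.trans (le_of_eq ?_)
  ring

lemma Datatype.Approx.abs_doublingLayer_sub_le [Mul M] (hD : D.Approx ε) (ν : NormKind)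
    (e : Fin d ≃ Fin 4 × Feature M) (eH : Fin w ≃ (M × M) ⊕ Fin 2) (hκ : 8 ≤ κ) (hd : d ≤ κ)
    (hw : w ≤ κ) (hn : 2 ≤ n) {s : ℕ} (hs : s ≤ n) (X : ℕ → M)
    {x : Fin (n + 1) → Fin (1 * d) → ℝ}
    (hx : ∀ i c, |x i c - lift e (windowFeatures X none i) c| ≤ η) (hεη : ε ≤ η)
    (hη : n ^ 5 * κ ^ 18 * η ≤ 1) (i : Fin (n + 1)) (c : Fin (1 * d)) :
    |(doublingLayer e eH s).apply D ν x i c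
      - lift e (windowFeatures (fun i => X i * X (i - s)) none i) c| ≤ κ ^ 18 * η := by
  have hε := hD.pos
  have hη0 : 0 < η := hε.trans_le hεη
  have hn' : (2 : ℝ) ≤ n := by exact_mod_cast hn
  have hs' : (s : ℝ) ≤ n := by exact_mod_cast hs
  have hκ1 : 1 ≤ κ := by linarith
  have hκ18 : κ ^ 18 * η ≤ 1 := by
    refine le_trans ?_ hη
    rw [mul_assoc]
    exact le_mul_of_one_le_left (by positivity) (one_le_pow₀ (by linarith))
  have hκ9 : κ ^ 9 * η ≤ κ ^ 18 * η := by
    have : κ ^ 9 ≤ κ ^ 18 := pow_le_pow_right₀ hκ1 (by norm_num)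
    gcongr
  have h8 : (n : ℝ) ^ 5 * κ ^ 8 * η * 512 ≤ 1 := by
    refine le_trans ?_ hη
    have : κ ^ 8 * 512 ≤ κ ^ 18 := by
      calc κ ^ 8 * 512 = κ ^ 8 * 8 ^ 3 := by norm_num
        _ ≤ κ ^ 8 * κ ^ 3 := by gcongr
        _ = κ ^ 11 := by ring
        _ ≤ κ ^ 18 := pow_le_pow_right₀ hκ1 (by norm_num)
    calc (n : ℝ) ^ 5 * κ ^ 8 * η * 512 = n ^ 5 * (κ ^ 8 * 512) * η := by ring
      _ ≤ _ := by gcongr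
  have hn8 : (n : ℝ) * κ ^ 8 * η ≤ 1 := by
    have : (n : ℝ) ≤ n ^ 5 := le_self_pow₀ (by linarith) (by norm_num)
    have : (n : ℝ) * κ ^ 8 * η ≤ n ^ 5 * κ ^ 8 * η := by gcongr
    have : 0 ≤ (n : ℝ) ^ 5 * κ ^ 8 * η := by positivity
    linarith
  have hatt : ∀ i c, |(featureAttention e (blockMask 4 0 ![0, 0, 0, 3, 3]) (shiftQuery s)
      fetchOut).apply D ν x i c - lift e (windowFeatures X (some (X (i - s))) i) c|
        ≤ κ ^ 9 * η := by
    intro i c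
    have hi : (i : ℕ) ≤ n := Nat.lt_succ_iff.1 i.isLt
    have hc := abs_le.1 (abs_posCos_le ((i : ℝ) + 1))
    have hs0 := posSin_nonneg ((i : ℝ) + 1)
    have hs1 := (abs_le.1 (abs_posSin_le ((i : ℝ) + 1))).2
    have hsS : (s : ℝ) * posSin (i + 1) ≤ n :=
      (mul_le_mul hs' hs1 hs0 (by linarith)).trans (by linarith)
    have hsS0 : 0 ≤ (s : ℝ) * posSin (i + 1) := by positivity
    -- The masked norm is `5` since `16 + 9 = 25`. Directions are read with factor `3 / 10`, so the
    -- gap is scaled by `4 * (3 / 10) ^ 2 = 9 / 25`; products are read as `2 / 5`.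
    refine hD.abs_attention_sub_le_of_gap ν e hκ hd
      (abs_blockMask_le (by norm_num) (by norm_num) (fun k => by fin_cases k <;> norm_num))
      (fun k k' => ?_) (n := n) (by linarith) (fun k k' => ?_) (R := 5) (by norm_num)
      (v := fun j => windowFeatures X none j) (fun j k => abs_windowFeatures_le X none j k)
      (fun j => ?_) hx (j := ⟨i - s, by omega⟩) (Fin.le_def.2 (Nat.sub_le _ _))
      (q := Sum.elim 0 ![0, 0, 0, 3 / 10 * (posCos (i + 1) - s * posSin (i + 1)),
        3 / 10 * posSin (i + 1)]) (fun k => ?_) (fun k => ?_)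
      (G := 9 / 25 * (1 / (32 * (n : ℝ) ^ 4))) (fun j' hj' hne => ?_)
      (abs_windowFeatures_le X (some (X (i - s))) i) (fun k => ?_) hεη (hκ9.trans hκ18) hn8 ?_ c
    · rcases k with (m | m) | k <;> rcases k' with (m' | m') | k' <;> simp only [fetchOut] <;>
        (try split_ifs) <;> norm_num
    · rcases k with (m | m) | k <;> rcases k' with (m' | m') | k' <;> simp only [shiftQuery] <;>
        (try split_ifs) <;> (try simp) <;> linarith
    · have := posCos_sq_add_posSin_sq ((j : ℝ) + 1)
      rw [Fintype.sum_sum_type, Fintype.sum_sum_type, Fin.sum_univ_five]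
      simp [blockMask, windowFeatures, features]
      linarith
    · rw [Fintype.sum_sum_type, Fin.sum_univ_five]
      rcases k with (m | m) | k
      · simp [shiftQuery]
      · simp [shiftQuery]
      · fin_cases k <;> simp [shiftQuery, maskedFeatures, blockMask, windowFeatures, features] <;>
          ring
    · rcases k with (m | m) | k
      · simp
      · simp
      · fin_cases k <;> simp [-abs_mul] <;> rw [abs_le] <;> constructor <;> linarith
    · have hgap := position_gap hn hi (Fin.le_def.1 hj') (s := s) (fun h => hne (Fin.ext h))
      simp only [Fintype.sum_sum_type, Fin.sum_univ_five]
      simp [maskedFeatures, blockMask, windowFeatures, features] at hgap ⊢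
      linarith
    · rw [Fintype.sum_sum_type, Fintype.sum_sum_type]
      rcases k with (m | m) | k
      · simp [fetchOut, windowFeatures, features]
      · simp [fetchOut, windowFeatures, features, maskedFeatures, blockMask]
        rw [Finset.sum_eq_single m (fun b _ hb => by simp [hb.symm]) (by simp)]
        by_cases h : m = X (i - s)
        · simp [h]
          norm_num
        · simp [h, Ne.symm h]
      · simp [fetchOut, windowFeatures, features]
    · have hn4 : (0 : ℝ) < n ^ 4 := by positivity
      have h1 : n * κ ^ 8 * η ≤ 1 / 16 * (1 / (32 * (n : ℝ) ^ 4)) := by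
        calc (n : ℝ) * κ ^ 8 * η = (n : ℝ) ^ 5 * κ ^ 8 * η / n ^ 4 := by field_simp
          _ ≤ 1 / 512 / (n : ℝ) ^ 4 := by gcongr; linarith
          _ = _ := by ring
      have h2 : 0 < 1 / (32 * (n : ℝ) ^ 4) := by positivity
      linarith
  -- The masked norm is `3` since `4 + 4 + 1 = 9`. Each one-hot entry is read as `1 / 3` and the
  -- constant contributes `-1 / 3`, so ReLU leaves `1 / 3` only at the pair present; output weights
  -- `± 3` rescale it.
  have hff := hD.abs_feedforward_sub_le ν e eH hκ hd hw
    (mask := blockMask 2 2 ![1, 0, 0, 0, 0])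
    (abs_blockMask_le (by norm_num) (by norm_num) (fun k => by fin_cases k <;> norm_num))
    (A := productIn)
    (fun b k => by
      rcases b with p | b <;> rcases k with (m | m) | k <;> simp only [productIn] <;>
        (try split_ifs) <;> norm_num)
    (U := productOut)
    (fun k b => by
      rcases k with (m | m) | k <;> rcases b with p | b <;> simp only [productOut] <;>
        (try split_ifs) <;> norm_num)
    (abs_windowFeatures_le X (some (X (i - s))) i) (R := 3) (by norm_num)
    (by
      rw [Fintype.sum_sum_type, Fintype.sum_sum_type, Fin.sum_univ_five]
      simp [blockMask, windowFeatures, features]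
      norm_num)
    (g := Sum.elim (fun p => if p = (X i, X (i - s)) then 1 / 3 else 0) 0)
    (fun b => by
      rw [Fintype.sum_sum_type, Fintype.sum_sum_type, Fin.sum_univ_five]
      rcases b with p | b
      · simp [productIn, maskedFeatures, blockMask, windowFeatures, features]
        rw [Finset.sum_eq_single p.1 (fun b _ hb => by simp [hb]) (by simp),
          Finset.sum_eq_single p.2 (fun b _ hb => by simp [hb]) (by simp)]
        have hcomm : X (i - s) = p.2 ↔ p.2 = X (i - s) := eq_comm
        by_cases h1 : p.1 = X i <;> by_cases h2 : p.2 = X (i - s) <;>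
          simp [h1, h2, hcomm, Prod.ext_iff] <;> norm_num
      · simp [productIn])
    (fun b => by
      rcases b with p | b
      · simp only [Sum.elim_inl]
        split_ifs <;> norm_num
      · simp)
    (abs_windowFeatures_le (fun i => X i * X (i - s)) none i)
    (fun k => by
      rw [Fintype.sum_sum_type]
      rcases k with (m | m) | k
      · simp [productOut, windowFeatures, features]
        split_ifs <;> norm_num
      · simp [productOut, windowFeatures, features]
        by_cases h : m = X (i - s)
        · simp [h]
        · simp [h, Ne.symm h]
      · simp [productOut, windowFeatures, features])
    i (hatt i) (hεη.trans (le_mul_of_one_le_left hη0.le (one_le_pow₀ hκ1)))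
    (by
      calc _ = κ ^ 18 * η := by ring
        _ ≤ 1 := hκ18) c
  refine hff.trans (le_of_eq ?_)
  ring

end Doubling

section Recognition

/-! ### Products over prefixes -/

section Prefix

variable {M : Type*} [Monoid M]

/-- The product over the window of length `2 ^ t` that ends at position `i ≤ n`. -/
def windowProd (tok : ℕ → M) (n : ℕ) : ℕ → ℕ → M
  | 0, i => tok i
  | t + 1, i => windowProd tok n t i * windowProd tok n t (i - min (2 ^ t) n)

/-- The product over the first `k` positions, the last one being leftmost. -/
def prefixProd (tok : ℕ → M) : ℕ → M
  | 0 => 1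
  | k + 1 => tok k * prefixProd tok k

lemma windowProd_zero_right {tok : ℕ → M} (h : tok 0 = 1) (n t : ℕ) : windowProd tok n t 0 = 1 := by
  induction t with
  | zero => exact h
  | succ t ih => simp [windowProd, ih]

/-- Truncated subtraction is intended: a window passing the start leaves an empty prefix, and a
fetch from position `0` contributes `1`. -/
lemma windowProd_mul_prefixProd {tok : ℕ → M} (h : tok 0 = 1) {n i : ℕ} (t : ℕ) (hi : i ≤ n) :
    windowProd tok n t i * prefixProd tok (i + 1 - 2 ^ t) = prefixProd tok (i + 1) := by
  induction t generalizing i with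
  | zero => simp [windowProd, prefixProd]
  | succ t ih =>
    -- Capping the shift at `n` changes nothing at positions up to `n`, but bounds the query
    -- entries.
    have hmin : i - min (2 ^ t) n = i - 2 ^ t := by
      rcases le_total (2 ^ t) n with h | h
      · rw [min_eq_left h]
      · rw [min_eq_right h]; omega
    rw [windowProd, hmin, mul_assoc]
    rcases le_or_gt (2 ^ t) i with ht | ht
    · have := ih (i := i - 2 ^ t) ((Nat.sub_le _ _).trans hi)
      have e1 : i + 1 - 2 ^ (t + 1) = i - 2 ^ t + 1 - 2 ^ t := by rw [pow_succ]; omega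
      have e2 : i - 2 ^ t + 1 = i + 1 - 2 ^ t := by omega
      rw [e1, this, e2, ih hi]
    · have e1 : i + 1 - 2 ^ (t + 1) = i + 1 - 2 ^ t := by rw [pow_succ]; omega
      rw [Nat.sub_eq_zero_of_le ht.le, windowProd_zero_right h, one_mul, e1, ih hi]

lemma windowProd_eq_prefixProd {tok : ℕ → M} (h : tok 0 = 1) {n t : ℕ} (ht : n + 1 ≤ 2 ^ t) :
    windowProd tok n t n = prefixProd tok (n + 1) := by
  have := windowProd_mul_prefixProd h t (le_refl n)
  rwa [Nat.sub_eq_zero_of_le ht, prefixProd, mul_one] at this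

lemma prefixProd_getD (l : List M) (k : ℕ) :
    prefixProd (fun i => l.getD i 1) k = (l.take k).reverse.prod := by
  induction k with
  | zero => simp [prefixProd]
  | succ k ih =>
    rw [prefixProd, ih, List.take_add_one, List.reverse_append, List.prod_append]
    congr 1
    rw [List.getD_eq_getElem?_getD]
    cases l[k]? <;> simp

end Prefix

/-- Multiplication in `Function.End` is composition, so the letter read first stands rightmost. -/
lemma prod_reverse_map_apply {σ α : Type*} (a : α → Function.End σ) (u : List α) (s : σ) :
    (u.map a).reverse.prod s = u.foldl (fun s x => a x s) s := by
  induction u generalizing s with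
  | nil => rfl
  | cons x u ih =>
    rw [List.map_cons, List.reverse_cons, List.prod_append, List.prod_singleton, List.foldl_cons,
      ← ih]
    rfl

/-! ### The transformers -/

/-- A layer that does not change the residual stream. -/
def zeroLayer (h d w : ℕ) : Layer h d w where
  attention := ⟨0, 0, 0, 0, 0⟩
  feedforward := ⟨0, 0, 0⟩

lemma zeroLayer_apply {D : Datatype} (h0 : D.round 0 = 0) (ν : NormKind) {h d w N : ℕ}
    {x : Fin N → Fin (h * d) → ℝ} (hx : ∀ i c, D.round (x i c) = x i c) :
    (zeroLayer h d w).apply D ν x = x := by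
  have h1 : (zeroLayer h d w).attention.apply D ν x = x := by
    funext i c
    refine Eq.trans ?_ (hx i c)
    refine congrArg D.round (add_eq_left.2 ?_)
    exact D.mulVec_zero h0 _ _ _ fun _ => rfl
  unfold Layer.apply
  rw [h1]
  funext i c
  refine Eq.trans ?_ (hx i c)
  refine congrArg D.round (add_eq_left.2 ?_)
  exact D.mulVec_zero h0 _ _ _ fun _ => rfl

open Classical in
/-- A transformer with layers that do nothing and a fixed output `y`. -/
def constTransformer {V : Type*} {h d w : ℕ} (c : Fin (h * d)) (y : V) (k : ℕ) :
    Transformer V h d w where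
  E _ := Pi.single c 1
  layers := List.replicate k (zeroLayer h d w)
  U y' := if y' = y then Pi.single c 1 else 0

/-- All relevant numbers are `0` or `1`, which are exact at every precision. -/
lemma constTransformer_outputs {D : Datatype} {q : ℕ} (hD : D.HasPrecision q) (ν : NormKind)
    {V : Type*} {h d w N : ℕ} (c : Fin (h * d)) (y : V) (k : ℕ) (t : Fin (N + 1) → V) :
    (constTransformer (w := w) c y k).Outputs D ν t y := by
  classical
  have h0 := D.round_eq_self hD.zero_mem
  have h1 := D.round_eq_self hD.one_mem
  have hround : ∀ c' : Fin (h * d),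
      D.round ((Pi.single c 1 : Fin (h * d) → ℚ) c' : ℝ) = if c' = c then 1 else 0 := by
    intro c'
    by_cases hc : c' = c
    · subst hc; simp [h1]
    · simp [hc, h0]
  have hres : (constTransformer (w := w) c y k).residual D ν t
      = fun _ c' => if c' = c then 1 else 0 := by
    unfold Transformer.residual constTransformer
    simp only [hround]
    induction k with
    | zero => rfl
    | succ k ih =>
      rw [List.replicate_succ, List.foldl_cons, zeroLayer_apply h0 ν, ih]
      intro _ c'
      split_ifs <;> assumption
  have hlogit : ∀ y', (constTransformer (w := w) c y k).logit D ν t y'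
      = if y' = y then 1 else 0 := by
    intro y'
    unfold Transformer.logit
    rw [hres]
    split_ifs with hy
    · unfold Datatype.mulVec
      rw [D.dot_single h0 _ _ c]
      · simp [constTransformer, hy, h1]
      · intro i hi
        simp [hi]
      · simp [constTransformer, hy, h1]
    · refine D.mulVec_zero h0 _ _ _ fun c' => ?_
      simp [constTransformer, hy]
  intro y' hy'
  rw [hlogit, hlogit, if_neg hy', if_pos rfl]
  exact one_pos

variable {α M : Type*} [Monoid M] [DecidableEq M] {d w : ℕ}

/-- The action of a token, given that of the symbols. -/
def tokenAction (a : α → M) : Vocab α → M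
  | .sym x => a x
  | _ => 1

/-- The features in the embedding of a token. -/
def embedding (a : α → M) (v : Vocab α) : Feature M → ℚ
  | .inl (.inl m) => if m = tokenAction a v then 1 else 0
  | .inl (.inr _) => 0
  | .inr k => ![1, (match v with | .bos => 1 | _ => 0), 0, 0, 0] k

open Classical in
/-- The unembedding: the token accept for the products in `P`, the beginning-of-sequence token for the
others. -/
def unembedding (P : Set M) : Vocab α → Feature M → ℚ
  | .accept, .inl (.inl m) => if m ∈ P then 1 else 0
  | .bos, .inl (.inl m) => if m ∈ P then 0 else 1
  | _, _ => 0

/-- The transformer that computes the product of the actions of `n` tokens by recursive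
doubling and accepts if it belongs to `P`. -/
def doublingTransformer (e : Fin d ≃ Fin 4 × Feature M) (eH : Fin w ≃ (M × M) ⊕ Fin 2) (a : α → M)
    (P : Set M) (n T : ℕ) : Transformer (Vocab α) 1 d w where
  E v c := copySign (coord e c).1 * embedding a v (coord e c).2
  layers := positionLayer e eH :: (List.range T).map fun t => doublingLayer e eH (min (2 ^ t) n)
  U y := readRow e (unembedding P y)

variable [Fintype M] {D : Datatype} {ε κ : ℝ}

/-- The position layer costs `n * κ ^ 18` and each doubling `κ ^ 18`. The further factor `n ^ 5 * κ
^ 18` in `hε` is the room needed for the score gaps. -/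
lemma Datatype.Approx.abs_residual_sub_le (hD : D.Approx ε) (ν : NormKind)
    (e : Fin d ≃ Fin 4 × Feature M) (eH : Fin w ≃ (M × M) ⊕ Fin 2) (hκ : 8 ≤ κ) (hd : d ≤ κ)
    (hw : w ≤ κ) (a : α → M) (P : Set M) {n : ℕ} (hn : 2 ≤ n) (T : ℕ)
    (hε : n ^ 6 * κ ^ (18 * (T + 2)) * ε ≤ 1) (t : Fin (n + 1) → Vocab α)
    (ht : ∀ i, t i = .bos ↔ i = 0) {tok : ℕ → M}
    (htok : ∀ i : Fin (n + 1), tok i = tokenAction a (t i))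
    (i : Fin (n + 1)) (c : Fin (1 * d)) :
    |(doublingTransformer e eH a P n T).residual D ν t i c
      - lift e (windowFeatures (windowProd tok n T) none i) c| ≤ n * κ ^ (18 * (T + 1)) * ε := by
  have hε0 := hD.pos
  have hn' : (2 : ℝ) ≤ n := by exact_mod_cast hn
  have hκ1 : 1 ≤ κ := by linarith
  have hκT : ∀ s ≤ T + 2, (n : ℝ) ^ 6 * κ ^ (18 * s) * ε ≤ 1 := fun s hs => by
    refine le_trans ?_ hε
    have : κ ^ (18 * s) ≤ κ ^ (18 * (T + 2)) := pow_le_pow_right₀ hκ1 (by omega)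
    gcongr
  have hinit : ∀ i c, |D.round ((copySign (coord e c).1 * embedding a (t i) (coord e c).2 : ℚ) : ℝ)
      - lift e (initFeatures tok i) c| ≤ ε := by
    intro i c
    have heq : ((copySign (coord e c).1 * embedding a (t i) (coord e c).2 : ℚ) : ℝ)
        = lift e (initFeatures tok i) c := by
      rw [lift, Rat.cast_mul]
      congr 1
      rcases (coord e c).2 with (m | m) | k
      · simp only [embedding, initFeatures, features, htok]
        split_ifs <;> simp
      · simp [embedding, initFeatures, features]
      · have h0 : (i : ℕ) = 0 ↔ t i = .bos := by
          rw [ht, Fin.ext_iff]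
          rfl
        simp only [embedding, initFeatures, features]
        generalize t i = v at h0 ⊢
        cases v <;> simp at h0 <;> fin_cases k <;> simp [h0]
    rw [heq]
    refine hD.abs_round_sub_le _ ?_
    rw [abs_lift]
    have := abs_initFeatures_le tok i (coord e c).2
    have := hD.le_one
    nlinarith
  have hmain : ∀ s ≤ T, ∀ i c,
      |((List.range s).map fun t => doublingLayer e eH (min (2 ^ t) n)).foldl
        (fun x ℓ => ℓ.apply D ν x) ((positionLayer e eH).apply D ν
          (fun i c => D.round ((copySign (coord e c).1 * embedding a (t i) (coord e c).2 : ℚ) : ℝ)))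
        i c - lift e (windowFeatures (windowProd tok n s) none i) c|
        ≤ n * κ ^ (18 * (s + 1)) * ε := by
    intro s
    induction s with
    | zero =>
      intro _ i c
      refine hD.abs_positionLayer_sub_le ν e eH hκ hd hw hn tok hinit le_rfl ?_ i c
      refine le_trans ?_ (hκT 1 (by omega))
      have : (n : ℝ) ≤ n ^ 6 := le_self_pow₀ (by linarith) (by norm_num)
      norm_num
      gcongr
    | succ s ih =>
      intro hs i c
      rw [List.range_succ, List.map_append, List.foldl_append]
      have hge : ε ≤ n * κ ^ (18 * (s + 1)) * ε :=
        le_mul_of_one_le_left hε0.le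
          (one_le_mul_of_one_le_of_one_le (by linarith) (one_le_pow₀ hκ1))
      refine (hD.abs_doublingLayer_sub_le ν e eH hκ hd hw hn (min_le_right _ _) _
        (ih (by omega)) hge ?_ i c).trans (le_of_eq ?_)
      · refine le_trans (le_of_eq ?_) (hκT (s + 2) (by omega))
        ring
      · ring
  exact hmain T le_rfl i c

lemma Datatype.Approx.doublingTransformer_recognizesAt (hD : D.Approx ε) (ν : NormKind)
    (e : Fin d ≃ Fin 4 × Feature M) (eH : Fin w ≃ (M × M) ⊕ Fin 2) (hκ : 8 ≤ κ) (hd : d ≤ κ)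
    (hw : w ≤ κ) (a : α → M) (P : Set M) (L : Language α) (u : List α) {n : ℕ} (hn : 2 ≤ n)
    {T : ℕ} (hT : n + 1 ≤ 2 ^ T) (hε : n ^ 6 * κ ^ (18 * (T + 2)) * ε ≤ 1)
    (hu : (withDollar u).length = n) (hL : (u.map a).reverse.prod ∈ P ↔ u ∈ L) :
    (doublingTransformer e eH a P n T).RecognizesAt D ν L u := by
  classical
  subst hu
  have hε0 := hD.pos
  have hκ1 : 1 ≤ κ := by linarith
  set n := (withDollar u).length with hndef
  have hn' : (2 : ℝ) ≤ n := by exact_mod_cast hn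
  set t : Fin (n + 1) → Vocab α := (Vocab.bos :: withDollar u).get with htdef
  set l : List M := (Vocab.bos :: withDollar u).map (tokenAction a) with hl
  have htok : ∀ i : Fin (n + 1), l.getD i 1 = tokenAction a (t i) := by
    intro i
    have hi : (i : ℕ) < l.length := by simpa [hl] using i.isLt
    rw [List.getD_eq_getElem _ _ hi]
    simp only [hl, List.getElem_map, htdef]
    rfl
  have ht : ∀ i, t i = .bos ↔ i = 0 := by
    intro i
    refine Fin.cases ?_ (fun j => ?_) i
    · simp [htdef]
    · refine iff_of_false (fun h => ?_) (Fin.succ_ne_zero j)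
      have hmem : Vocab.bos ∈ withDollar u := by
        rw [← h]
        exact List.get_mem (withDollar u) j
      simp [withDollar] at hmem
  have hres := hD.abs_residual_sub_le ν e eH hκ hd hw a P hn T hε t ht
    (tok := fun i => l.getD i 1) htok (Fin.last n)
  -- Both special tokens act as the identity, so the product over all `n + 1` tokens is that of `u`.
  have hprod : windowProd (fun i => l.getD i 1) n T n = (u.map a).reverse.prod := by
    rw [windowProd_eq_prefixProd (by simp [hl, tokenAction]) hT, prefixProd_getD,
      List.take_of_length_le (by simp [hl, hndef])]
    simp [hl, withDollar, tokenAction, Function.comp_def]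
  rw [Fin.val_last] at hres
  set η := n * κ ^ (18 * (T + 1)) * ε with hη
  have hεη : ε ≤ η := le_mul_of_one_le_left hε0.le
    (one_le_mul_of_one_le_of_one_le (by linarith) (one_le_pow₀ hκ1))
  have hηκ : κ ^ 18 * η ≤ 1 := by
    refine le_trans ?_ hε
    have : (n : ℝ) ≤ n ^ 6 := le_self_pow₀ (by linarith) (by norm_num)
    calc κ ^ 18 * η = n * κ ^ (18 * (T + 2)) * ε := by rw [hη]; ring
      _ ≤ _ := by gcongr
  have hη0 : 0 < η := hε0.trans_le hεη
  have hκ3 : κ ^ 3 * η ≤ 1 := by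
    refine le_trans ?_ hηκ
    have : κ ^ 3 ≤ κ ^ 18 := pow_le_pow_right₀ hκ1 (by norm_num)
    gcongr
  have h64 : 64 ≤ κ ^ 2 := by nlinarith
  have hκ36 : κ * 36 * η ≤ 1 := by
    refine le_trans ?_ hκ3
    have : κ * 36 ≤ κ ^ 3 := by nlinarith
    gcongr
  have hκη : κ * η ≤ 1 / 36 := by linarith
  -- The ideal logits are `0` and `1`; an error below `1 / 2` keeps them apart.
  have hlogit : ∀ y, |(doublingTransformer e eH a P n T).logit D ν t y
      - unembedding P y (.inl (.inl (u.map a).reverse.prod))| ≤ 8 / 36 := by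
    intro y
    have hm : (((1 * d : ℕ) : ℝ)) ≤ κ := by simpa using hd
    have h1 := hD.abs_mulVec_sub_le (fun y => readRow e (unembedding P y)) y (B := 4) (by norm_num)
      (abs_readRow_le e (by norm_num) (fun k => by
        unfold unembedding
        split <;> (try split_ifs) <;> norm_num)) hres
      (fun c => by rw [abs_lift]; exact abs_windowFeatures_le _ _ _ _) hεη
      (by nlinarith) (by nlinarith)
    rw [sum_readRow_lift, Fintype.sum_sum_type, Fintype.sum_sum_type, Finset.sum_eq_single
      (windowProd (fun i => l.getD i 1) n T n)
      (fun m _ hm => by simp only [windowFeatures, features, if_neg hm, mul_zero]) (by simp), hprod] at h1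
    have hz1 : ∀ m, unembedding P y (.inl (.inr m)) = 0 := by intro m; cases y <;> rfl
    have hz2 : ∀ k, unembedding P y (.inr k) = 0 := by intro m; cases y <;> rfl
    simp only [hz1, hz2, Rat.cast_zero, zero_mul, Finset.sum_const_zero, add_zero, windowFeatures,
      features, if_true, mul_one, hprod] at h1
    refine h1.trans ?_
    have : (((1 * d : ℕ) : ℝ)) * η ≤ κ * η := by gcongr
    linarith
  refine ⟨if u ∈ L then .accept else .bos, fun y' hy' => ?_, by split_ifs with h <;> simp [h]⟩
  have h1 := abs_le.1 (hlogit y')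
  have h2 := abs_le.1 (hlogit (if u ∈ L then .accept else .bos))
  have e1 : unembedding P y' (.inl (.inl (u.map a).reverse.prod)) = 0 := by
    split_ifs at hy' with h
    · cases y' <;> simp_all [unembedding]
    · cases y' <;> simp_all [unembedding]
  have e2 : unembedding P (if u ∈ L then Vocab.accept else Vocab.bos : Vocab α)
      (.inl (.inl (u.map a).reverse.prod)) = 1 := by
    split_ifs with h
    · simp [unembedding, hL, h]
    · simp [unembedding, hL, h]
  rw [e1] at h1
  rw [e2] at h2
  push_cast at h1 h2
  change (doublingTransformer e eH a P n T).logit D ν t y' < _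
  linarith [h1.2, h2.1]

end Recognition

end

end LogDepth

/-! ### Choice of the constants for a given automaton. -/

theorem mainTheorem4 {α : Type*} [Fintype α] (L : Language α) (hL : L.IsRegular)
    (ν : LogDepth.NormKind) :
    ∃ (h d w c : ℕ) (T : ℕ → LogDepth.Transformer (LogDepth.Vocab α) h d w),
      ∀ n : ℕ, 1 ≤ n →
        (T n).layers.length = 4 * ⌈Real.logb 2 n⌉₊ + 5 ∧
        ∀ (D : LogDepth.Datatype) (q : ℕ), D.HasPrecision q → n ^ c ≤ 2 ^ q →
          ∀ u : List α, (LogDepth.withDollar u).length = n → (T n).RecognizesAt D ν L u := by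
  classical
  obtain ⟨σ, _, A, rfl⟩ := hL
  have : Finite (Function.End σ) := (inferInstance : Finite (σ → σ))
  have := Fintype.ofFinite (Function.End σ)
  let e := (Fintype.equivFin (Fin 4 × LogDepth.Feature (Function.End σ))).symm
  let eH := (Fintype.equivFin ((Function.End σ × Function.End σ) ⊕ Fin 2)).symm
  set d := Fintype.card (Fin 4 × LogDepth.Feature (Function.End σ))
  set w := Fintype.card ((Function.End σ × Function.End σ) ⊕ Fin 2)
  let a : α → Function.End σ := fun x s => A.step s x
  let P : Set (Function.End σ) := {f | f A.start ∈ A.accept}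
  have hP : ∀ u : List α, (u.map a).reverse.prod ∈ P ↔ u ∈ A.accepts := by
    intro u
    refine Iff.trans ?_ A.mem_accepts.symm
    change (u.map a).reverse.prod A.start ∈ A.accept ↔ _
    rw [LogDepth.prod_reverse_map_apply]
    rfl
  obtain ⟨k, hk⟩ : ∃ k, d + w + 8 ≤ 2 ^ k := ⟨_, Nat.lt_two_pow_self.le⟩
  -- For `n = 1` the bound `1 ^ c ≤ 2 ^ q` guarantees no precision, but only the empty string occurs
  -- and a constant answer suffices.
  refine ⟨1, d, w, 252 * k + 6, fun n => if n = 1 then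
      LogDepth.constTransformer ((LogDepth.coord e).symm (0, .inr 0))
        (if ([] : List α) ∈ A.accepts then .accept else .bos) 5
    else LogDepth.doublingTransformer e eH a P n (4 * ⌈Real.logb 2 n⌉₊ + 4), fun n hn => ?_⟩
  by_cases hn1 : n = 1
  · subst hn1
    beta_reduce
    rw [if_pos rfl]
    refine ⟨by simp [LogDepth.constTransformer], fun D q hD _ u hu => ?_⟩
    have hu' : u = [] := by
      rw [LogDepth.withDollar] at hu
      simpa using hu
    subst hu'
    exact ⟨_, LogDepth.constTransformer_outputs hD ν _ _ _ _, by split_ifs with h <;> simp [h]⟩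
  · beta_reduce
    rw [if_neg hn1]
    refine ⟨by simp [LogDepth.doublingTransformer], fun D q hD hq u hu => ?_⟩
    have hn2 : 2 ≤ n := by omega
    have hclog : ⌈Real.logb 2 n⌉₊ = Nat.clog 2 n := by
      exact_mod_cast Real.natCeil_logb_natCast 2 n
    rw [hclog]
    set ℓ := Nat.clog 2 n
    have hℓ1 : n ≤ 2 ^ ℓ := Nat.le_pow_clog (by norm_num) n
    have hℓ2 : 2 ^ ℓ ≤ 2 * n := by
      have h1 := Nat.pow_pred_clog_lt_self (b := 2) (by norm_num) (x := n) (by omega)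
      have h2 : 0 < ℓ := Nat.clog_pos (by norm_num) hn2
      obtain ⟨m, hm⟩ := Nat.exists_eq_succ_of_ne_zero h2.ne'
      change 2 ^ (ℓ - 1) < n at h1
      rw [hm] at h1 ⊢
      rw [pow_succ]
      simp only [Nat.succ_eq_add_one, Nat.add_sub_cancel] at h1
      omega
    -- With `2 ^ ℓ ≤ 2 * n ≤ n ^ 2` and `2 ≤ n`, the exponents `144 * k` and `108 * k` add up to
    -- `252 * k`.
    have hbound : n ^ 6 * (2 ^ k) ^ (18 * (4 * ℓ + 4 + 2)) ≤ 2 ^ q := by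
      refine le_trans ?_ hq
      calc n ^ 6 * (2 ^ k) ^ (18 * (4 * ℓ + 4 + 2))
          = n ^ 6 * ((2 ^ ℓ) ^ (72 * k) * 2 ^ (108 * k)) := by
            rw [← pow_mul, ← pow_mul, ← pow_add]
            ring_nf
        _ ≤ n ^ 6 * ((n ^ 2) ^ (72 * k) * n ^ (108 * k)) := by
            refine Nat.mul_le_mul_left _ (Nat.mul_le_mul (Nat.pow_le_pow_left ?_ _)
              (Nat.pow_le_pow_left hn2 _))
            nlinarith
        _ = n ^ (252 * k + 6) := by
            rw [← pow_mul, ← pow_add, ← pow_add]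
            ring_nf
    have hcast : ∀ m : ℕ, m ≤ 2 ^ k → (m : ℝ) ≤ 2 ^ k := fun m hm => by exact_mod_cast hm
    refine hD.approx.doublingTransformer_recognizesAt ν e eH (κ := 2 ^ k)
      (by exact_mod_cast hcast 8 (by omega)) (hcast _ (by omega)) (hcast _ (by omega)) a P _ u hn2
      ?_ ?_ hu (hP u)
    -- Already `ℓ + 1` doublings cover the input; the others only reach the prescribed depth.
    · calc n + 1 ≤ 2 ^ ℓ * 2 := by omega
        _ = 2 ^ (ℓ + 1) := (pow_succ 2 ℓ).symm
        _ ≤ 2 ^ (4 * ℓ + 4) := Nat.pow_le_pow_right (by norm_num) (by omega)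
    · rw [mul_one_div, div_le_one (by positivity)]
      exact_mod_cast hbound
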